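/- Let $\lambda\in(0,\infty)$ and $\beta\in(1,\infty)$, and let $\alpha$ be a random variable with values in $(0,1)$ having a probability density of the form $\psi(x)(1-x)^\beta$, $x\in(0,1)$, where $\psi$ is a function on $(0,1)$ with $\lim_{x\uparrow1}\psi(x)=\psi_1\in(0,\infty)$. Let $X_0$, $\xi_{k,i}$, $\varepsilon_k$ ($k,i\ge1$) be random variables that are conditionally independent given $\alpha$, such that, given $\alpha$, $X_0$ is Poisson distributed with mean $\lambda/(1-\alpha)$, each $\varepsilon_k$ is Poisson distributed with mean $\lambda$, and each $\xi_{k,i}$ is Bernoulli distributed with mean $\alpha$. Define the stationary randomized INAR(1) process $(X_k)_{k\ge0}$ by $$X_k=\sum_{i=1}^{X_{k-1}}\xi_{k,i}+\varepsilon_k,\qquad k\ge1 .$$ Let $(X^{(j)}_k)_{k\ge0}$, $j\ge1$, be independent copies of $(X_k)_{k\ge 0}$ (each with its own independent copy $\alpha^{(j)}$ of $\alpha$, innovations and counting variables), and for $N,n\in\{1,2,\dots\}$ put $$S^{(N,n)}_t:=\sum_{j=1}^N\sum_{k=1}^{\lfloor nt\rfloor}\bigl(X^{(j)}_k-\mathbb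 E X^{(j)}_k\bigr),\qquad t\in[0,\infty).$$ Write $\mathcal D_f\text{-}\lim$ for the limit in the sense of weak convergence of all finite-dimensional distributions of processes indexed by $t\in[0,\infty)$; in an iterated limit the inner limit process exists for each value of the outer index. Then $\mathbb E X^{(j)}_k<\infty$ for all $j,k$, $\mathbb E\bigl((1-\alpha)^{-2}\bigr)<\infty$, and $$\mathcal D_f\text{-}\lim_{n\to\infty}\,\mathcal D_f\text{-}\lim_{N\to\infty}\,n^{-1}N^{-1/2}S^{(N,n)}=\mathcal D_f\text{-}\lim_{N\to\infty}\,\mathcal D_f\text{-}\lim_{n\to\infty}\,n^{-1}N^{-1/2}S^{(N,n)}=(W\,t)_{t\in[0,\infty)},$$ where $W$ is a normally distributed random variable with mean $0$ and variance $\lambda^2\operatorname{Var}\bigl((1-\alpha)^{-1}\bigr)$. -/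

import Mathlib

open MeasureTheory ProbabilityTheory Filter Topology
open scoped NNReal ENNReal

/-- A realization of the randomness driving one INAR(1) path: the initial value `X₀`, the
innovations `ε₁, ε₂, …` (the `k`-th entry is `ε_{k+1}`) and the counting variables of the thinning
(the entry at `(k, i)` is `ξ_{k+1,i+1}`). -/
abbrev INARNoise : Type := ℕ × (ℕ → ℕ) × (ℕ × ℕ → ℕ)

/-- The INAR(1) recursion `X_k = ∑_{i=1}^{X_{k-1}} ξ_{k,i} + ε_k`, `k ≥ 1`, started from `X₀`. -/
def inarPath (y : INARNoise) : ℕ → ℕ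
  | 0 => y.1
  | k + 1 => (∑ i ∈ Finset.range (inarPath y k), y.2.2 (k, i)) + y.2.1 k

/-- The law of the driving variables when the thinning parameter equals `a ∈ (0, 1)`: all of them
are independent, `X₀` is Poisson with mean `lam / (1 - a)`, the innovations are Poisson with mean
`lam`, and the counting variables are Bernoulli with mean `a`. (The value for `a ∉ (0, 1)` plays
no role.) -/
noncomputable def inarNoiseLaw (lam a : ℝ) : Measure INARNoise :=
  (poissonMeasure (lam / (1 - a)).toNNReal).prod
    ((Measure.infinitePi fun _ : ℕ => poissonMeasure lam.toNNReal).prod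
      (Measure.infinitePi fun _ : ℕ × ℕ =>
        bernoulliMeasure (1 : ℕ) 0 (Set.projIcc (0 : ℝ) 1 zero_le_one a)))

/-- `α` has a probability density of the form `ψ(x) (1 - x)^β` on `(0, 1)`, where `ψ` has a
limit `ψ₁ ∈ (0, ∞)` at `1` from the left. -/
structure HasMixingDensity {Ω : Type*} [MeasurableSpace Ω] (μ : Measure Ω) (α : Ω → ℝ)
    (ψ : ℝ → ℝ) (β ψ₁ : ℝ) : Prop where
  measurable : Measurable α
  aemeasurable_density : AEMeasurable ψ (volume.restrict (Set.Ioo 0 1))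
  density_nonneg : ∀ x ∈ Set.Ioo (0 : ℝ) 1, 0 ≤ ψ x
  law : μ.map α = (volume.restrict (Set.Ioo (0 : ℝ) 1)).withDensity
    fun x => ENNReal.ofReal (ψ x * (1 - x) ^ β)
  limit_pos : 0 < ψ₁
  tendsto_limit : Tendsto ψ (𝓝[<] 1) (𝓝 ψ₁)

/-- The pairs `(α j, Y j)`, `j = 0, 1, …`, are independent, and the conditional law of the driving
variables `Y j` given `α j = a` is `inarNoiseLaw lam a`. Hence the processes
`k ↦ inarPath (Y j ω) k` are independent copies of the stationary randomized INAR(1) process with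
Poisson innovations. -/
structure IsRandomizedINARFamily {Ω : Type*} [MeasurableSpace Ω] (μ : Measure Ω)
    [IsProbabilityMeasure μ] (lam : ℝ) (α : ℕ → Ω → ℝ) (Y : ℕ → Ω → INARNoise) : Prop where
  measurable_coeff : ∀ j, Measurable (α j)
  measurable_noise : ∀ j, Measurable (Y j)
  indep : iIndepFun (fun j ω => (α j ω, Y j ω)) μ
  cond_law : ∀ j, ∀ᵐ a ∂(μ.map (α j)), condDistrib (Y j) (α j) μ a = inarNoiseLaw lam a

/-- The aggregated process centred by the unconditional mean,
`S_t^{(N,n)} = ∑_{j=1}^N ∑_{k=1}^{⌊nt⌋} (X_k^{(j)} - E X_k^{(j)})`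
(the copies are numbered from `0` to `N - 1`). -/
noncomputable def aggregatedSum {Ω : Type*} [MeasurableSpace Ω] (μ : Measure Ω)
    (Y : ℕ → Ω → INARNoise) (N n : ℕ) (t : ℝ≥0) (ω : Ω) : ℝ :=
  ∑ j ∈ Finset.range N, ∑ k ∈ Finset.Icc 1 ⌊(n : ℝ) * t⌋₊,
    ((inarPath (Y j ω) k : ℝ) - ∫ ω', (inarPath (Y j ω') k : ℝ) ∂μ)

/-- The processes `Z m` on `(Ω m, μ m)` converge to the process `V` on `(Ω', ν)` as `m → ∞`, in the
sense of weak convergence of all finite-dimensional distributions. -/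
def FddTendsto {Ω : ℕ → Type*} [∀ m, MeasurableSpace (Ω m)] (Z : ∀ m, ℝ≥0 → Ω m → ℝ)
    (μ : ∀ m, Measure (Ω m)) [∀ m, IsProbabilityMeasure (μ m)]
    {Ω' : Type*} [MeasurableSpace Ω'] (V : ℝ≥0 → Ω' → ℝ) (ν : Measure Ω')
    [IsProbabilityMeasure ν] : Prop :=
  ∀ I : Finset ℝ≥0, TendstoInDistribution (fun m ω (t : I) => Z m t ω) atTop
    (fun ω (t : I) => V t ω) μ ν

/-- The iterated limit `lim_{m → ∞} lim_{l → ∞} Z m l = V` in the sense of finite-dimensional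
distributions: for each `m ≥ 1` the processes `Z m l` converge as `l → ∞` to some process, taken
to be the coordinate process under a probability measure `Q m` on the path space
`ℝ≥0 → ℝ` with the product σ-algebra, and these limits converge to `V` as `m → ∞`. -/
def IteratedFddLimit {Ω : Type*} [MeasurableSpace Ω] (Z : ℕ → ℕ → ℝ≥0 → Ω → ℝ)
    (μ : Measure Ω) [IsProbabilityMeasure μ] {Ω' : Type*} [MeasurableSpace Ω']
    (V : ℝ≥0 → Ω' → ℝ) (ν : Measure Ω') [IsProbabilityMeasure ν] : Prop :=
  ∃ Q : ℕ → ProbabilityMeasure (ℝ≥0 → ℝ),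
    (∀ m, 1 ≤ m → FddTendsto (fun l => Z m l) (fun _ => μ)
      (fun t (w : ℝ≥0 → ℝ) => w t) (Q m : Measure (ℝ≥0 → ℝ))) ∧
    FddTendsto (fun _ t (w : ℝ≥0 → ℝ) => w t) (fun m => (Q m : Measure (ℝ≥0 → ℝ))) V ν

/-! Given `α = a`, the path has constant mean `lam / (1 - a)` and covariances `a ^ |k - l| * lam /
(1 - a)`. Their sum over `k, l ≤ nt` grows only linearly in `n`, so the time average of `X_k - lam /
(1 - a)` tends to zero in L² given `α = a`. What survives is the randomness of the conditional mean:
for one copy, `n⁻¹ ∑_{k ≤ nt} (X_k - E X_k)` converges in L² to `t * c`, where `c = lam * ((1 - α)⁻¹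
- E (1 - α)⁻¹)` (`tendsto_eLpNorm_average`). The variable `c` is square integrable because `β > 1`
makes `(1 - x) ^ (β - 2)` integrable at 1, and its variance is the variance of `W`.

Both iterated limits combine this L² limit with the central limit theorem for i.i.d. copies, in
opposite orders. With `N → ∞` first, a linear combination of the averages at finitely many times has
a Gaussian limit whose variance is its squared L² norm; these norms converge as `n → ∞`. With `n →
∞` first, each of the finitely many copies converges in L², and the central limit theorem then
applies to the copies of `c`. The Cramér–Wold device reduces finite-dimensional convergence to such
linear combinations.

The intermediate limits must be laws on path space. For `n` first, the law is that of an explicit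
process on the original space. For `N` first, it is built from a Gaussian sequence with the
covariances of `(X_k)`, obtained by Gram–Schmidt in L² (`exists_gaussian_sequence`).

Only first and second moments of the path are needed, so stationarity of its law is never invoked.
They are computed in `ℝ≥0∞`, where sums and integrals commute without integrability conditions. -/

/-! ### Moments of the Poisson and Bernoulli laws -/

/-- The Stein–Chen identity: the Poisson weights satisfy `(n + 1) p(n + 1) = r p(n)`, and the term
at zero vanishes. Taking `f = 1` and `f = id` gives the first two moments. -/
lemma lintegral_natCast_mul_poissonMeasure (r : ℝ≥0) (f : ℕ → ℝ≥0∞) :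
    ∫⁻ n, (n : ℝ≥0∞) * f n ∂(poissonMeasure r) = r * ∫⁻ n, f (n + 1) ∂(poissonMeasure r) := by
  rw [lintegral_countable', lintegral_countable',
    tsum_eq_zero_add' (f := fun n : ℕ => (n : ℝ≥0∞) * f n * poissonMeasure r {n})
      ENNReal.summable, ← ENNReal.tsum_mul_left]
  simp only [Nat.cast_zero, zero_mul, zero_add]
  refine tsum_congr fun n => ?_
  have key : ((n + 1 : ℕ) : ℝ≥0∞) * poissonMeasure r {n + 1} = r * poissonMeasure r {n} := by
    rw [poissonMeasure_singleton, poissonMeasure_singleton, ← ENNReal.ofReal_natCast,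
      ← ENNReal.ofReal_coe_nnreal, ← ENNReal.ofReal_mul (by positivity),
      ← ENNReal.ofReal_mul (by positivity)]
    congr 1
    rw [Nat.factorial_succ]
    push_cast
    field_simp
    ring
  rw [mul_right_comm, key]
  ring

lemma lintegral_natCast_poissonMeasure (r : ℝ≥0) :
    ∫⁻ n, (n : ℝ≥0∞) ∂(poissonMeasure r) = r := by
  simpa using lintegral_natCast_mul_poissonMeasure r 1

lemma lintegral_natCast_sq_poissonMeasure (r : ℝ≥0) :
    ∫⁻ n, (n : ℝ≥0∞) ^ 2 ∂(poissonMeasure r) = r ^ 2 + r := by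
  simp_rw [sq]
  rw [lintegral_natCast_mul_poissonMeasure r (fun n => (n : ℝ≥0∞))]
  simp only [Nat.cast_add, Nat.cast_one]
  rw [lintegral_add_right _ measurable_const, lintegral_natCast_poissonMeasure]
  simp [mul_add]

lemma lintegral_natCast_bernoulliMeasure (p : unitInterval) :
    ∫⁻ n, (n : ℝ≥0∞) ∂(bernoulliMeasure (1 : ℕ) 0 p) = ENNReal.ofReal p := by
  rw [bernoulliMeasure_def, lintegral_add_measure, lintegral_smul_measure, lintegral_smul_measure]
  simp only [lintegral_dirac, Nat.cast_one, Nat.cast_zero, smul_zero, add_zero]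
  rw [ENNReal.smul_def, smul_eq_mul, mul_one, ENNReal.ofReal]
  congr 1
  ext
  simp [p.2.1]

lemma lintegral_natCast_sq_bernoulliMeasure (p : unitInterval) :
    ∫⁻ n, (n : ℝ≥0∞) ^ 2 ∂(bernoulliMeasure (1 : ℕ) 0 p) = ENNReal.ofReal p := by
  rw [← lintegral_natCast_bernoulliMeasure, bernoulliMeasure_def]
  simp [lintegral_add_measure, lintegral_smul_measure]

/-! ### Independence of the driving coordinates and adaptedness of the path -/

/-- A finite intersection of events, each depending on one factor only, is a rectangle, so the
product measure factorizes. -/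
lemma ProbabilityTheory.iIndepFun.sumElim {ι₁ ι₂ Ω₁ Ω₂ β : Type*} [MeasurableSpace Ω₁]
    [MeasurableSpace Ω₂] [MeasurableSpace β] {P₁ : Measure Ω₁} {P₂ : Measure Ω₂}
    [IsProbabilityMeasure P₁] [IsProbabilityMeasure P₂] {X₁ : ι₁ → Ω₁ → β} {X₂ : ι₂ → Ω₂ → β}
    (h₁ : iIndepFun X₁ P₁) (h₂ : iIndepFun X₂ P₂) :
    iIndepFun (Sum.elim (fun i ω => X₁ i ω.1) fun i ω => X₂ i ω.2) (P₁.prod P₂) := by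
  rw [iIndepFun_iff_measure_inter_preimage_eq_mul] at *
  intro S A hA
  have e : (⋂ i ∈ S, Sum.elim (fun i (ω : Ω₁ × Ω₂) => X₁ i ω.1) (fun i ω => X₂ i ω.2) i ⁻¹' A i) =
      (⋂ i ∈ S.toLeft, X₁ i ⁻¹' A (.inl i)) ×ˢ (⋂ i ∈ S.toRight, X₂ i ⁻¹' A (.inr i)) := by
    ext ω
    simp
  have hl : ∀ i, (P₁.prod P₂) ((fun ω : Ω₁ × Ω₂ => X₁ i ω.1) ⁻¹' A (.inl i)) =
      P₁ (X₁ i ⁻¹' A (.inl i)) := fun i => by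
    rw [show (fun ω : Ω₁ × Ω₂ => X₁ i ω.1) ⁻¹' A (.inl i) = (X₁ i ⁻¹' A (.inl i)) ×ˢ Set.univ by
      ext; simp, Measure.prod_prod, measure_univ, mul_one]
  have hr : ∀ i, (P₁.prod P₂) ((fun ω : Ω₁ × Ω₂ => X₂ i ω.2) ⁻¹' A (.inr i)) =
      P₂ (X₂ i ⁻¹' A (.inr i)) := fun i => by
    rw [show (fun ω : Ω₁ × Ω₂ => X₂ i ω.2) ⁻¹' A (.inr i) = Set.univ ×ˢ (X₂ i ⁻¹' A (.inr i)) by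
      ext; simp, Measure.prod_prod, measure_univ, one_mul]
  rw [e, Measure.prod_prod, h₁ _ fun i hi => hA _ (by simpa using hi),
    h₂ _ fun i hi => hA _ (by simpa using hi)]
  conv_rhs => rw [← S.toLeft_disjSum_toRight, Finset.prod_disjSum]
  simp only [Sum.elim_inl, Sum.elim_inr, hl, hr]

/-- The coordinates of the driving variables: the initial value, the innovations and the counting
variables. -/
def noiseCoord : Unit ⊕ ℕ ⊕ (ℕ × ℕ) → INARNoise → ℕ :=
  Sum.elim (fun _ y => y.1) fun i y =>
    Sum.elim (fun k (z : (ℕ → ℕ) × (ℕ × ℕ → ℕ)) => z.1 k) (fun p z => z.2 p) i y.2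

instance (lam a : ℝ) : IsProbabilityMeasure (inarNoiseLaw lam a) := by
  unfold inarNoiseLaw; infer_instance

lemma iIndepFun_noiseCoord (lam a : ℝ) : iIndepFun noiseCoord (inarNoiseLaw lam a) := by
  refine iIndepFun.sumElim (X₁ := fun _ : Unit => id) (X₂ := Sum.elim
    (fun k (z : (ℕ → ℕ) × (ℕ × ℕ → ℕ)) => z.1 k) (fun p z => z.2 p)) .of_subsingleton ?_
  refine iIndepFun.sumElim (X₁ := fun k (z : ℕ → ℕ) => z k)
    (X₂ := fun k (z : ℕ × ℕ → ℕ) => z k) ?_ ?_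
  · exact iIndepFun_infinitePi (X := fun _ => id) fun _ => measurable_id
  · exact iIndepFun_infinitePi (X := fun _ => id) fun _ => measurable_id

lemma measurable_noiseCoord (i : Unit ⊕ ℕ ⊕ (ℕ × ℕ)) : Measurable (noiseCoord i) := by
  rcases i with _ | k | p
  · exact measurable_fst
  · exact (measurable_pi_apply k).comp (measurable_fst.comp measurable_snd)
  · exact (measurable_pi_apply p).comp (measurable_snd.comp measurable_snd)

lemma map_fst_inarNoiseLaw (lam a : ℝ) :
    (inarNoiseLaw lam a).map (noiseCoord (.inl ())) = poissonMeasure (lam / (1 - a)).toNNReal := by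
  have : noiseCoord (.inl ()) = Prod.fst := rfl
  rw [this, inarNoiseLaw, Measure.map_fst_prod]
  simp

lemma map_innovation_inarNoiseLaw (lam a : ℝ) (k : ℕ) :
    (inarNoiseLaw lam a).map (noiseCoord (.inr (.inl k))) = poissonMeasure lam.toNNReal := by
  have : noiseCoord (.inr (.inl k)) = (fun z : ℕ → ℕ => z k) ∘ Prod.fst ∘ Prod.snd := rfl
  rw [this, inarNoiseLaw, ← Measure.map_map (by fun_prop) (by fun_prop),
    ← Measure.map_map (by fun_prop) (by fun_prop), Measure.map_snd_prod, measure_univ, one_smul,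
    Measure.map_fst_prod, measure_univ, one_smul, Measure.infinitePi_map_eval]

lemma map_counting_inarNoiseLaw (lam a : ℝ) (p : ℕ × ℕ) :
    (inarNoiseLaw lam a).map (noiseCoord (.inr (.inr p))) =
      bernoulliMeasure (1 : ℕ) 0 (Set.projIcc (0 : ℝ) 1 zero_le_one a) := by
  have : noiseCoord (.inr (.inr p)) = (fun z : ℕ × ℕ → ℕ => z p) ∘ Prod.snd ∘ Prod.snd := rfl
  rw [this, inarNoiseLaw, ← Measure.map_map (by fun_prop) (by fun_prop),
    ← Measure.map_map (by fun_prop) (by fun_prop), Measure.map_snd_prod, measure_univ, one_smul,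
    Measure.map_snd_prod, measure_univ, one_smul, Measure.infinitePi_map_eval]

/-- The σ-algebra on the driving variables generated by the coordinates in `S`. -/
abbrev noiseSigma (S : Set (Unit ⊕ ℕ ⊕ (ℕ × ℕ))) : MeasurableSpace INARNoise :=
  ⨆ i ∈ S, MeasurableSpace.comap (noiseCoord i) ⊤

lemma noiseSigma_le (S : Set (Unit ⊕ ℕ ⊕ (ℕ × ℕ))) :
    noiseSigma S ≤ (inferInstance : MeasurableSpace INARNoise) :=
  iSup₂_le fun i _ => (measurable_noiseCoord i).comap_le

lemma noiseSigma_mono {S T : Set (Unit ⊕ ℕ ⊕ (ℕ × ℕ))} (h : S ⊆ T) :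
    noiseSigma S ≤ noiseSigma T :=
  biSup_mono h

lemma measurable_noiseCoord_noiseSigma {S : Set (Unit ⊕ ℕ ⊕ (ℕ × ℕ))} {i} (hi : i ∈ S) :
    Measurable[noiseSigma S] (noiseCoord i) :=
  measurable_iff_comap_le.2 (le_iSup₂ (f := fun j (_ : j ∈ S) =>
    MeasurableSpace.comap (noiseCoord j) (⊤ : MeasurableSpace ℕ)) i hi)

/-- The form in which independence enters every moment computation: a fresh coordinate factors out
of any functional of the coordinates in `S`. -/
lemma lintegral_mul_noiseCoord (lam a : ℝ) {S : Set (Unit ⊕ ℕ ⊕ (ℕ × ℕ))} {i} (hi : i ∉ S)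
    {f : INARNoise → ℝ≥0∞} (hf : Measurable[noiseSigma S] f) (g : ℕ → ℝ≥0∞) :
    ∫⁻ y, f y * g (noiseCoord i y) ∂(inarNoiseLaw lam a) =
      (∫⁻ y, f y ∂(inarNoiseLaw lam a)) *
        ∫⁻ n, g n ∂((inarNoiseLaw lam a).map (noiseCoord i)) := by
  have hind : Indep (noiseSigma S) (noiseSigma {i}) (inarNoiseLaw lam a) :=
    indep_iSup_of_disjoint (fun j => (measurable_noiseCoord j).comap_le)
      (iIndepFun_noiseCoord lam a).iIndep (by simpa using hi)
  rw [lintegral_map (measurable_from_top (f := g)) (measurable_noiseCoord i)]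
  exact lintegral_mul_eq_lintegral_mul_lintegral_of_independent_measurableSpace (noiseSigma_le S)
    (noiseSigma_le {i}) hind hf
    ((measurable_from_top (f := g)).comp (measurable_noiseCoord_noiseSigma rfl))

/-- The coordinates on which the path up to time `k` depends. -/
def pastCoords (k : ℕ) : Set (Unit ⊕ ℕ ⊕ (ℕ × ℕ)) :=
  {i | Sum.elim (fun _ => True) (Sum.elim (fun l => l < k) fun p => p.1 < k) i}

lemma pastCoords_mono : Monotone pastCoords := by
  rintro k l h (_ | j | p) hi
  · trivial
  · exact lt_of_lt_of_le hi h
  · exact lt_of_lt_of_le hi h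

lemma measurable_finsetSum_range_random {α : Type*} {m : MeasurableSpace α} {N : α → ℕ}
    (hN : Measurable N) {f : ℕ → α → ℕ} (hf : ∀ i, Measurable (f i)) :
    Measurable fun x => ∑ i ∈ Finset.range (N x), f i x := by
  have : Measurable fun p : ℕ × α => ∑ i ∈ Finset.range p.1, f i p.2 :=
    measurable_from_prod_countable_right fun n => by
      simpa using Finset.measurable_fun_sum (Finset.range n) fun i _ => hf i
  exact this.comp (hN.prodMk measurable_id)

/-- The number of survivors of the thinning at time `k + 1`. -/
def inarSurvivors (y : INARNoise) (k : ℕ) : ℕ :=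
  ∑ i ∈ Finset.range (inarPath y k), noiseCoord (.inr (.inr (k, i))) y

lemma inarPath_succ (y : INARNoise) (k : ℕ) :
    inarPath y (k + 1) = inarSurvivors y k + noiseCoord (.inr (.inl k)) y := rfl

/-- The coordinates on which the survivors at time `k + 1` depend. -/
def survivorCoords (k : ℕ) : Set (Unit ⊕ ℕ ⊕ (ℕ × ℕ)) :=
  pastCoords (k + 1) \ {.inr (.inl k)}

lemma pastCoords_subset_survivorCoords (k : ℕ) : pastCoords k ⊆ survivorCoords k := fun i hi =>
  ⟨pastCoords_mono k.le_succ hi, by rintro rfl; exact lt_irrefl k hi⟩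

lemma measurable_inarSurvivors_noiseSigma {k : ℕ}
    (h : Measurable[noiseSigma (pastCoords k)] fun y => inarPath y k) :
    Measurable[noiseSigma (survivorCoords k)] fun y => inarSurvivors y k :=
  measurable_finsetSum_range_random
    (h.mono (noiseSigma_mono (pastCoords_subset_survivorCoords k)) le_rfl)
    fun _ => measurable_noiseCoord_noiseSigma ⟨Nat.lt_succ_self k, by simp⟩

lemma measurable_inarPath_noiseSigma (k : ℕ) :
    Measurable[noiseSigma (pastCoords k)] fun y => inarPath y k := by
  induction k with
  | zero => exact measurable_noiseCoord_noiseSigma (i := .inl ()) trivial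
  | succ k ih =>
    simp only [inarPath_succ]
    have h1 : Measurable[noiseSigma (pastCoords (k + 1))] fun y => inarSurvivors y k :=
      (measurable_inarSurvivors_noiseSigma ih).mono (noiseSigma_mono Set.sdiff_subset) le_rfl
    have h2 : Measurable[noiseSigma (pastCoords (k + 1))] (noiseCoord (.inr (.inl k))) :=
      measurable_noiseCoord_noiseSigma (Nat.lt_succ_self k)
    exact h1.add h2

lemma measurable_inarPath (k : ℕ) : Measurable fun y : INARNoise => inarPath y k :=
  (measurable_inarPath_noiseSigma k).mono (noiseSigma_le _) le_rfl

/-! ### Moments of the path for a fixed thinning parameter -/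

lemma tsum_indicator_lt (n : ℕ) : ∑' i : ℕ, (if i < n then 1 else 0 : ℝ≥0∞) = n := by
  rw [tsum_eq_sum (s := Finset.range n) (by simp)]
  rw [Finset.sum_congr rfl fun i hi => if_pos (Finset.mem_range.1 hi)]
  simp

/-- Replaces the random number of summands by a full series in which each term is a function of the
past times a fresh counting variable. -/
lemma cast_inarSurvivors (y : INARNoise) (k : ℕ) :
    (inarSurvivors y k : ℝ≥0∞) =
      ∑' i, (if i < inarPath y k then 1 else 0) * (noiseCoord (.inr (.inr (k, i))) y : ℝ≥0∞) := by
  rw [tsum_eq_sum (s := Finset.range (inarPath y k)) (by simp +contextual [not_lt.2]), inarSurvivors]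
  push_cast
  refine Finset.sum_congr rfl fun i hi => ?_
  simp [Finset.mem_range.1 hi]

lemma measurable_natCast_comp {α : Type*} {m : MeasurableSpace α} {f : α → ℕ} (hf : Measurable f) :
    Measurable fun x => (f x : ℝ≥0∞) :=
  measurable_from_top.comp hf

lemma measurable_lt_inarPath_noiseSigma (k i : ℕ) :
    Measurable[noiseSigma (pastCoords k)] fun y => (if i < inarPath y k then 1 else 0 : ℝ≥0∞) :=
  (measurable_from_top (f := fun n : ℕ => (if i < n then 1 else 0 : ℝ≥0∞))).comp
    (measurable_inarPath_noiseSigma k)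

section
variable {lam a : ℝ}

lemma lintegral_counting (ha : a ∈ Set.Ioo (0 : ℝ) 1) (p : ℕ × ℕ) :
    ∫⁻ n, (n : ℝ≥0∞) ∂((inarNoiseLaw lam a).map (noiseCoord (.inr (.inr p)))) =
      ENNReal.ofReal a := by
  rw [map_counting_inarNoiseLaw, lintegral_natCast_bernoulliMeasure,
    Set.projIcc_of_mem _ (Set.Ioo_subset_Icc_self ha)]

lemma lintegral_counting_sq (ha : a ∈ Set.Ioo (0 : ℝ) 1) (p : ℕ × ℕ) :
    ∫⁻ n, (n : ℝ≥0∞) ^ 2 ∂((inarNoiseLaw lam a).map (noiseCoord (.inr (.inr p)))) =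
      ENNReal.ofReal a := by
  rw [map_counting_inarNoiseLaw, lintegral_natCast_sq_bernoulliMeasure,
    Set.projIcc_of_mem _ (Set.Ioo_subset_Icc_self ha)]

lemma lintegral_innovation (k : ℕ) :
    ∫⁻ n, (n : ℝ≥0∞) ∂((inarNoiseLaw lam a).map (noiseCoord (.inr (.inl k)))) =
      ENNReal.ofReal lam := by
  rw [map_innovation_inarNoiseLaw, lintegral_natCast_poissonMeasure, ENNReal.ofReal]

lemma lintegral_innovation_sq (k : ℕ) :
    ∫⁻ n, (n : ℝ≥0∞) ^ 2 ∂((inarNoiseLaw lam a).map (noiseCoord (.inr (.inl k)))) =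
      ENNReal.ofReal lam ^ 2 + ENNReal.ofReal lam := by
  rw [map_innovation_inarNoiseLaw, lintegral_natCast_sq_poissonMeasure, ENNReal.ofReal]

/-- Wald's identity with a past weight `f`: each counting variable contributes its mean `a`. The
weight `f = 1` yields means, and `f` an earlier value of the path yields covariances. -/
lemma lintegral_mul_inarSurvivors (ha : a ∈ Set.Ioo (0 : ℝ) 1) {k : ℕ} {f : INARNoise → ℝ≥0∞}
    (hf : Measurable[noiseSigma (pastCoords k)] f) :
    ∫⁻ y, f y * inarSurvivors y k ∂(inarNoiseLaw lam a) =
      ENNReal.ofReal a * ∫⁻ y, f y * inarPath y k ∂(inarNoiseLaw lam a) := by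
  have hm : ∀ i, Measurable[noiseSigma (pastCoords k)]
      fun y => f y * (if i < inarPath y k then 1 else 0 : ℝ≥0∞) := fun i =>
    hf.mul (measurable_lt_inarPath_noiseSigma k i)
  have hm' := fun i => (hm i).mono (noiseSigma_le _) le_rfl
  have hX : ∀ y : INARNoise, f y * inarPath y k =
      ∑' i, f y * (if i < inarPath y k then 1 else 0 : ℝ≥0∞) := fun y => by
    rw [ENNReal.tsum_mul_left, tsum_indicator_lt]
  simp_rw [cast_inarSurvivors, ← ENNReal.tsum_mul_left, hX, ← mul_assoc]
  have hmξ : ∀ i, Measurable fun y => (f y * (if i < inarPath y k then 1 else 0 : ℝ≥0∞)) *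
      (noiseCoord (.inr (.inr (k, i))) y : ℝ≥0∞) := fun i =>
    (hm' i).mul (measurable_natCast_comp (measurable_noiseCoord _))
  rw [lintegral_tsum fun i => (hmξ i).aemeasurable,
    lintegral_tsum fun i => (hm' i).aemeasurable, ← ENNReal.tsum_mul_left]
  refine tsum_congr fun i => ?_
  rw [lintegral_mul_noiseCoord lam a (S := pastCoords k) (by simp [pastCoords]) (hm i)
    (fun n => (n : ℝ≥0∞)), lintegral_counting ha, mul_comm]

lemma lintegral_mul_inarPath_succ (ha : a ∈ Set.Ioo (0 : ℝ) 1) {k : ℕ} {f : INARNoise → ℝ≥0∞}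
    (hf : Measurable[noiseSigma (pastCoords k)] f) :
    ∫⁻ y, f y * inarPath y (k + 1) ∂(inarNoiseLaw lam a) =
      ENNReal.ofReal a * ∫⁻ y, f y * inarPath y k ∂(inarNoiseLaw lam a) +
        (∫⁻ y, f y ∂(inarNoiseLaw lam a)) * ENNReal.ofReal lam := by
  have hε := lintegral_mul_noiseCoord lam a (S := pastCoords k) (i := .inr (.inl k))
    (by simp [pastCoords]) hf (fun n => (n : ℝ≥0∞))
  rw [lintegral_innovation] at hε
  rw [← lintegral_mul_inarSurvivors ha hf, ← hε, ← lintegral_add_right]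
  · simp_rw [inarPath_succ, Nat.cast_add, mul_add]
  · exact (hf.mono (noiseSigma_le _) le_rfl).mul (measurable_natCast_comp (measurable_noiseCoord _))

/-- In the double series over pairs of individuals, off-diagonal pairs contribute `a ^ 2`, while
diagonal pairs contribute `a = a ^ 2 + a * (1 - a)`; the excess is summed over the diagonal only. -/
lemma lintegral_inarSurvivors_sq (ha : a ∈ Set.Ioo (0 : ℝ) 1) (k : ℕ) :
    ∫⁻ y, (inarSurvivors y k : ℝ≥0∞) ^ 2 ∂(inarNoiseLaw lam a) =
      ENNReal.ofReal a ^ 2 * ∫⁻ y, (inarPath y k : ℝ≥0∞) ^ 2 ∂(inarNoiseLaw lam a) +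
        ENNReal.ofReal (a * (1 - a)) * ∫⁻ y, (inarPath y k : ℝ≥0∞) ∂(inarNoiseLaw lam a) := by
  set I : ℕ → INARNoise → ℝ≥0∞ := fun i y => if i < inarPath y k then 1 else 0 with hI
  have hIm : ∀ i, Measurable[noiseSigma (pastCoords k)] (I i) :=
    measurable_lt_inarPath_noiseSigma k
  have hIm' := fun i => (hIm i).mono (noiseSigma_le _) le_rfl
  set ξ : ℕ → INARNoise → ℝ≥0∞ := fun i y => (noiseCoord (.inr (.inr (k, i))) y : ℝ≥0∞) with hξ
  have hξm : ∀ i, Measurable (ξ i) := fun i => measurable_natCast_comp (measurable_noiseCoord _)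
  have hS : ∀ y, (inarSurvivors y k : ℝ≥0∞) ^ 2 = ∑' i, ∑' j, I i y * I j y * ξ i y * ξ j y := by
    intro y
    rw [cast_inarSurvivors, sq, ← ENNReal.tsum_mul_right]
    refine tsum_congr fun i => ?_
    rw [← ENNReal.tsum_mul_left]
    refine tsum_congr fun j => ?_
    ring
  have hX : ∀ y, (inarPath y k : ℝ≥0∞) ^ 2 = ∑' i, ∑' j, I i y * I j y := by
    intro y
    simp_rw [ENNReal.tsum_mul_left, ENNReal.tsum_mul_right, hI, tsum_indicator_lt, sq]
  -- The diagonal part is also written as a double series so that the identity can be checked pair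
  -- by pair.
  have hX1 : ∀ y, (inarPath y k : ℝ≥0∞) = ∑' i, ∑' j, if i = j then I i y * I j y else 0 := by
    intro y
    simp_rw [tsum_ite_eq']
    rw [← tsum_indicator_lt]
    refine tsum_congr fun i => ?_
    by_cases h : i < inarPath y k <;> simp [hI, h]
  have hij : ∀ i j, ∫⁻ y, I i y * I j y * ξ i y * ξ j y ∂(inarNoiseLaw lam a) =
      ENNReal.ofReal a ^ 2 * ∫⁻ y, I i y * I j y ∂(inarNoiseLaw lam a) +
        ENNReal.ofReal (a * (1 - a)) *
          ∫⁻ y, (if i = j then I i y * I j y else 0) ∂(inarNoiseLaw lam a) := by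
    intro i j
    have hn : ∀ i, .inr (.inr (k, i)) ∉ pastCoords k := fun i => by simp [pastCoords]
    by_cases h : i = j
    · subst h
      have h1 : ∫⁻ y, I i y * I i y * ξ i y ^ 2 ∂(inarNoiseLaw lam a) = _ :=
        lintegral_mul_noiseCoord lam a (hn i) ((hIm i).mul (hIm i)) (fun n => (n : ℝ≥0∞) ^ 2)
      rw [lintegral_counting_sq ha] at h1
      simp_rw [sq (ξ i _), ← mul_assoc] at h1
      simp only [h1, if_true, Pi.mul_apply]
      rw [← add_mul, mul_comm, ← ENNReal.ofReal_pow ha.1.le,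
        ← ENNReal.ofReal_add (sq_nonneg a) (mul_nonneg ha.1.le (sub_nonneg.2 ha.2.le))]
      congr 2
      ring
    · have h1 : ∫⁻ y, I i y * I j y * ξ i y ∂(inarNoiseLaw lam a) = _ :=
        lintegral_mul_noiseCoord lam a (hn i) ((hIm i).mul (hIm j)) (fun n => (n : ℝ≥0∞))
      -- The two counting variables are removed in turn: `ξ j` is independent of the past enlarged
      -- by `ξ i`.
      have hm : Measurable[noiseSigma (insert (.inr (.inr (k, i))) (pastCoords k))]
          (fun y => I i y * I j y * ξ i y) :=
        (((hIm i).mul (hIm j)).mono (noiseSigma_mono (Set.subset_insert _ _)) le_rfl).mul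
          (measurable_natCast_comp (measurable_noiseCoord_noiseSigma (Set.mem_insert _ _)))
      have h2 : ∫⁻ y, I i y * I j y * ξ i y * ξ j y ∂(inarNoiseLaw lam a) = _ :=
        lintegral_mul_noiseCoord lam a (i := .inr (.inr (k, j))) (by simpa [Ne.symm h] using hn j) hm (fun n => (n : ℝ≥0∞))
      rw [lintegral_counting ha] at h1 h2
      simp only [h2, h1, h, if_false, lintegral_zero, mul_zero, add_zero, Pi.mul_apply]
      ring
  simp_rw [hS, hX]
  conv_rhs => simp only [hX1]
  have hmi : ∀ i j, Measurable fun y => I i y * I j y := fun i j => (hIm' i).mul (hIm' j)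
  have hmite : ∀ i j, Measurable fun y => if i = j then I i y * I j y else 0 := fun i j => by
    by_cases h : i = j
    · simpa [h] using hmi j j
    · simp [h]
  have hmξ : ∀ i j, Measurable fun y => I i y * I j y * ξ i y * ξ j y := fun i j =>
    ((hmi i j).mul (hξm i)).mul (hξm j)
  have swap : ∀ F : ℕ → ℕ → INARNoise → ℝ≥0∞, (∀ i j, Measurable (F i j)) →
      ∫⁻ y, ∑' i, ∑' j, F i j y ∂(inarNoiseLaw lam a) =
        ∑' i, ∑' j, ∫⁻ y, F i j y ∂(inarNoiseLaw lam a) := by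
    intro F hF
    rw [lintegral_tsum fun i => (Measurable.tsum (hF i)).aemeasurable]
    exact tsum_congr fun i => lintegral_tsum fun j => (hF i j).aemeasurable
  rw [swap _ hmξ, swap _ hmi, swap _ hmite]
  simp_rw [hij, ENNReal.tsum_add, ENNReal.tsum_mul_left]

/-- Expand the square of survivors plus innovation; the cross term factorizes because the survivors
do not involve the new innovation. -/
lemma lintegral_inarPath_sq_succ (ha : a ∈ Set.Ioo (0 : ℝ) 1) (k : ℕ) :
    ∫⁻ y, (inarPath y (k + 1) : ℝ≥0∞) ^ 2 ∂(inarNoiseLaw lam a) =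
      ENNReal.ofReal a ^ 2 * ∫⁻ y, (inarPath y k : ℝ≥0∞) ^ 2 ∂(inarNoiseLaw lam a) +
        ENNReal.ofReal (a * (1 - a)) * ∫⁻ y, (inarPath y k : ℝ≥0∞) ∂(inarNoiseLaw lam a) +
        2 * (ENNReal.ofReal a * ∫⁻ y, (inarPath y k : ℝ≥0∞) ∂(inarNoiseLaw lam a)) *
          ENNReal.ofReal lam + (ENNReal.ofReal lam ^ 2 + ENNReal.ofReal lam) := by
  have hSm := measurable_natCast_comp
    (measurable_inarSurvivors_noiseSigma (measurable_inarPath_noiseSigma k))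
  have hSm' := hSm.mono (noiseSigma_le _) le_rfl
  have hε := lintegral_mul_noiseCoord lam a (S := survivorCoords k) (i := .inr (.inl k))
    (by simp [survivorCoords]) hSm (fun n => (n : ℝ≥0∞))
  have hε2 := lintegral_map (μ := inarNoiseLaw lam a)
    (measurable_from_top (f := fun n : ℕ => (n : ℝ≥0∞) ^ 2)) (measurable_noiseCoord (.inr (.inl k)))
  have hεm := measurable_natCast_comp (measurable_noiseCoord (.inr (.inl k)))
  have hS := lintegral_mul_inarSurvivors (lam := lam) ha (k := k) (f := 1)
    (@measurable_const _ _ _ (noiseSigma (pastCoords k)) 1)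
  simp only [Pi.one_apply, one_mul] at hS
  rw [lintegral_innovation, hS] at hε
  rw [lintegral_innovation_sq] at hε2
  have hm1 : Measurable fun y => (inarSurvivors y k : ℝ≥0∞) ^ 2 := hSm'.pow_const 2
  have hm2 : Measurable fun y =>
      (inarSurvivors y k : ℝ≥0∞) * (noiseCoord (.inr (.inl k)) y : ℝ≥0∞) := hSm'.mul hεm
  have hm3 : Measurable fun y => (inarSurvivors y k : ℝ≥0∞) ^ 2 +
      2 * ((inarSurvivors y k : ℝ≥0∞) * (noiseCoord (.inr (.inl k)) y : ℝ≥0∞)) :=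
    hm1.add (hm2.const_mul 2)
  rw [← lintegral_inarSurvivors_sq ha, hε2, mul_assoc 2, ← hε,
    ← lintegral_const_mul _ hm2, ← lintegral_add_left hm1, ← lintegral_add_left hm3]
  refine lintegral_congr fun y => ?_
  rw [inarPath_succ]
  push_cast
  ring

/-- The initial mean is the fixed point of `m = a * m + lam`. -/
lemma lintegral_inarPath (hlam : 0 < lam) (ha : a ∈ Set.Ioo (0 : ℝ) 1) (k : ℕ) :
    ∫⁻ y, (inarPath y k : ℝ≥0∞) ∂(inarNoiseLaw lam a) = ENNReal.ofReal (lam / (1 - a)) := by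
  have h1 : 0 < 1 - a := sub_pos.2 ha.2
  induction k with
  | zero =>
    rw [ENNReal.ofReal, ← lintegral_natCast_poissonMeasure, ← map_fst_inarNoiseLaw,
      lintegral_map measurable_from_top (measurable_noiseCoord _)]
    rfl
  | succ k ih =>
    have := lintegral_mul_inarPath_succ (lam := lam) ha (k := k) (f := 1)
      (@measurable_const _ _ _ (noiseSigma (pastCoords k)) 1)
    simp only [Pi.one_apply, one_mul, lintegral_one, measure_univ] at this
    have ha0 := ha.1
    rw [this, ih, ← ENNReal.ofReal_mul ha.1.le, ← ENNReal.ofReal_add (by positivity) hlam.le]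
    congr 1
    field_simp
    ring

/-- With `m = lam / (1 - a)`, the Poisson second moment `m ^ 2 + m` is fixed by the second-moment
recursion. -/
lemma lintegral_inarPath_sq (hlam : 0 < lam) (ha : a ∈ Set.Ioo (0 : ℝ) 1) (k : ℕ) :
    ∫⁻ y, (inarPath y k : ℝ≥0∞) ^ 2 ∂(inarNoiseLaw lam a) =
      ENNReal.ofReal ((lam / (1 - a)) ^ 2 + lam / (1 - a)) := by
  have h1 : 0 < 1 - a := sub_pos.2 ha.2
  have ha0 := ha.1
  induction k with
  | zero =>
    rw [ENNReal.ofReal_add (by positivity) (by positivity), ENNReal.ofReal_pow (by positivity),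
      ENNReal.ofReal, ← lintegral_natCast_sq_poissonMeasure, ← map_fst_inarNoiseLaw,
      lintegral_map measurable_from_top (measurable_noiseCoord _)]
    rfl
  | succ k ih =>
    rw [lintegral_inarPath_sq_succ ha, ih, lintegral_inarPath hlam ha,
      ← ENNReal.ofReal_ofNat 2]
    simp only [← ENNReal.ofReal_pow ha0.le, ← ENNReal.ofReal_pow hlam.le]
    rw [← ENNReal.ofReal_mul (by positivity), ← ENNReal.ofReal_mul (by positivity),
      ← ENNReal.ofReal_mul (by positivity), ← ENNReal.ofReal_mul (by positivity),
      ← ENNReal.ofReal_mul (by positivity), ← ENNReal.ofReal_add (by positivity) (by positivity),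
      ← ENNReal.ofReal_add (by positivity) (by positivity),
      ← ENNReal.ofReal_add (by positivity) (by positivity),
      ← ENNReal.ofReal_add (by positivity) (by positivity)]
    congr 1
    field_simp
    ring

lemma lintegral_inarPath_mul_inarPath (hlam : 0 < lam) (ha : a ∈ Set.Ioo (0 : ℝ) 1) (k d : ℕ) :
    ∫⁻ y, (inarPath y k : ℝ≥0∞) * inarPath y (k + d) ∂(inarNoiseLaw lam a) =
      ENNReal.ofReal ((lam / (1 - a)) ^ 2 + a ^ d * (lam / (1 - a))) := by
  have h1 : 0 < 1 - a := sub_pos.2 ha.2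
  have ha0 := ha.1
  induction d with
  | zero => simpa [sq] using lintegral_inarPath_sq hlam ha k
  | succ d ih =>
    have hm : Measurable[noiseSigma (pastCoords (k + d))] fun y => (inarPath y k : ℝ≥0∞) :=
      measurable_natCast_comp ((measurable_inarPath_noiseSigma k).mono
        (noiseSigma_mono (pastCoords_mono (Nat.le_add_right k d))) le_rfl)
    rw [← add_assoc, lintegral_mul_inarPath_succ ha hm, ih, lintegral_inarPath hlam ha,
      ← ENNReal.ofReal_mul (by positivity), ← ENNReal.ofReal_mul (by positivity),
      ← ENNReal.ofReal_add (by positivity) (by positivity)]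
    congr 1
    field_simp
    ring

end

/-! ### Covariances and second moments of centred sums for a fixed parameter -/

lemma sum_pow_le_inv_one_sub {a : ℝ} (ha : a ∈ Set.Ioo (0 : ℝ) 1) (s : Finset ℕ) {g : ℕ → ℕ}
    (hg : Set.InjOn g s) : ∑ l ∈ s, a ^ g l ≤ (1 - a)⁻¹ := by
  rw [← Finset.sum_image (f := fun d => a ^ d) hg, ← tsum_geometric_of_lt_one ha.1.le ha.2]
  exact (summable_geometric_of_lt_one ha.1.le ha.2).sum_le_tsum _ fun i _ => pow_nonneg ha.1.le i

/-- With truncated subtraction the exponent is `|k - l|`. It is injective in `l` on each side of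
`k`, so each side is bounded by the full geometric series. -/
lemma sum_pow_dist_le {a : ℝ} (ha : a ∈ Set.Ioo (0 : ℝ) 1) (s : Finset ℕ) (k : ℕ) :
    ∑ l ∈ s, a ^ ((k - l) + (l - k)) ≤ 2 * (1 - a)⁻¹ := by
  rw [← Finset.sum_filter_add_sum_filter_not s (· ≤ k), two_mul]
  refine add_le_add (sum_pow_le_inv_one_sub ha _ ?_) (sum_pow_le_inv_one_sub ha _ ?_)
  · intro i hi j hj h
    simp only [Finset.coe_filter, Set.mem_ofPred_eq] at hi hj h
    lia
  · intro i hi j hj h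
    simp only [Finset.coe_filter, Set.mem_ofPred_eq] at hi hj h
    lia

section
variable {lam a : ℝ}

lemma lintegral_ofReal_natCast {α : Type*} [MeasurableSpace α] (P : Measure α) (f : α → ℕ) :
    ∫⁻ y, ENNReal.ofReal (f y : ℝ) ∂P = ∫⁻ y, (f y : ℝ≥0∞) ∂P := by
  simp

lemma memLp_two_natCast_of_lintegral_sq_lt_top {α : Type*} [MeasurableSpace α] {P : Measure α}
    {f : α → ℕ} (hf : Measurable f) (h : ∫⁻ y, (f y : ℝ≥0∞) ^ 2 ∂P < ∞) :
    MemLp (fun y => (f y : ℝ)) 2 P := by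
  have hm : Measurable fun y => (f y : ℝ) := measurable_from_top.comp hf
  rw [memLp_two_iff_integrable_sq hm.aestronglyMeasurable]
  refine ⟨(hm.pow_const 2).aestronglyMeasurable, ?_⟩
  rw [hasFiniteIntegral_iff_ofReal (.of_forall fun y => by positivity)]
  simpa [ENNReal.ofReal_pow] using h

lemma measurable_inarPath_real (k : ℕ) : Measurable fun y : INARNoise => (inarPath y k : ℝ) :=
  measurable_from_top.comp (measurable_inarPath k)

lemma memLp_inarPath (hlam : 0 < lam) (ha : a ∈ Set.Ioo (0 : ℝ) 1) (k : ℕ) :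
    MemLp (fun y => (inarPath y k : ℝ)) 2 (inarNoiseLaw lam a) := by
  refine memLp_two_natCast_of_lintegral_sq_lt_top (measurable_inarPath k) ?_
  rw [lintegral_inarPath_sq hlam ha]
  exact ENNReal.ofReal_lt_top

lemma integral_inarPath (hlam : 0 < lam) (ha : a ∈ Set.Ioo (0 : ℝ) 1) (k : ℕ) :
    ∫ y, (inarPath y k : ℝ) ∂(inarNoiseLaw lam a) = lam / (1 - a) := by
  have h1 : 0 < 1 - a := sub_pos.2 ha.2
  rw [integral_eq_lintegral_of_nonneg_ae (.of_forall fun y => by positivity)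
    (measurable_inarPath_real k).aestronglyMeasurable, lintegral_ofReal_natCast,
    lintegral_inarPath hlam ha, ENNReal.toReal_ofReal (by positivity)]

lemma integral_inarPath_mul_add (hlam : 0 < lam) (ha : a ∈ Set.Ioo (0 : ℝ) 1) (k d : ℕ) :
    ∫ y, (inarPath y k : ℝ) * inarPath y (k + d) ∂(inarNoiseLaw lam a) =
      (lam / (1 - a)) ^ 2 + a ^ d * (lam / (1 - a)) := by
  have h1 : 0 < 1 - a := sub_pos.2 ha.2
  have ha0 := ha.1
  have hm : Measurable fun y : INARNoise => (inarPath y k : ℝ) * inarPath y (k + d) :=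
    (measurable_inarPath_real k).mul (measurable_inarPath_real _)
  rw [integral_eq_lintegral_of_nonneg_ae (.of_forall fun y => by positivity)
    hm.aestronglyMeasurable]
  simp_rw [ENNReal.ofReal_mul (Nat.cast_nonneg _), ENNReal.ofReal_natCast]
  rw [lintegral_inarPath_mul_inarPath hlam ha, ENNReal.toReal_ofReal (by positivity)]

lemma integral_inarPath_mul (hlam : 0 < lam) (ha : a ∈ Set.Ioo (0 : ℝ) 1) (k l : ℕ) :
    ∫ y, (inarPath y k : ℝ) * inarPath y l ∂(inarNoiseLaw lam a) =
      (lam / (1 - a)) ^ 2 + a ^ ((k - l) + (l - k)) * (lam / (1 - a)) := by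
  rcases le_total k l with h | h
  · obtain ⟨d, rfl⟩ := Nat.exists_eq_add_of_le h
    rw [integral_inarPath_mul_add hlam ha]
    simp
  · obtain ⟨d, rfl⟩ := Nat.exists_eq_add_of_le h
    simp_rw [mul_comm (inarPath _ (l + d) : ℝ)]
    rw [integral_inarPath_mul_add hlam ha]
    simp

lemma integral_centred_mul_centred (hlam : 0 < lam) (ha : a ∈ Set.Ioo (0 : ℝ) 1) (k l : ℕ) :
    ∫ y, ((inarPath y k : ℝ) - lam / (1 - a)) * (inarPath y l - lam / (1 - a))
      ∂(inarNoiseLaw lam a) = a ^ ((k - l) + (l - k)) * (lam / (1 - a)) := by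
  have hk := memLp_inarPath hlam ha k
  have hl := memLp_inarPath hlam ha l
  have hkl : Integrable (fun y => (inarPath y k : ℝ) * inarPath y l) (inarNoiseLaw lam a) :=
    hk.integrable_mul hl
  have hk1 := hk.integrable one_le_two
  have hl1 := hl.integrable one_le_two
  set m := lam / (1 - a) with hm
  have e : ∀ y : INARNoise, ((inarPath y k : ℝ) - m) * (inarPath y l - m) =
      (inarPath y k : ℝ) * inarPath y l - (m * inarPath y k + m * inarPath y l - m ^ 2) :=
    fun y => by ring
  have hs : Integrable (fun y => m * (inarPath y k : ℝ) + m * inarPath y l)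
      (inarNoiseLaw lam a) := (hk1.const_mul m).add (hl1.const_mul m)
  have hs' : Integrable (fun y => m * (inarPath y k : ℝ) + m * inarPath y l - m ^ 2)
      (inarNoiseLaw lam a) := hs.sub (integrable_const _)
  simp_rw [e]
  rw [integral_sub hkl hs', integral_sub hs (integrable_const _),
    integral_add (hk1.const_mul m) (hl1.const_mul m), integral_const_mul, integral_const_mul,
    integral_inarPath hlam ha, integral_inarPath hlam ha, integral_inarPath_mul hlam ha]
  simp
  ring

lemma memLp_sum_centred (hlam : 0 < lam) (ha : a ∈ Set.Ioo (0 : ℝ) 1) (s : Finset ℕ) :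
    MemLp (fun y => ∑ k ∈ s, ((inarPath y k : ℝ) - lam / (1 - a))) 2 (inarNoiseLaw lam a) :=
  memLp_finsetSum _ fun k _ => (memLp_inarPath hlam ha k).sub (memLp_const _)

lemma integral_sq_sum_centred (hlam : 0 < lam) (ha : a ∈ Set.Ioo (0 : ℝ) 1) (s : Finset ℕ) :
    ∫ y, (∑ k ∈ s, ((inarPath y k : ℝ) - lam / (1 - a))) ^ 2 ∂(inarNoiseLaw lam a) =
      ∑ k ∈ s, ∑ l ∈ s, a ^ ((k - l) + (l - k)) * (lam / (1 - a)) := by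
  have hU : ∀ k, MemLp (fun y => (inarPath y k : ℝ) - lam / (1 - a)) 2 (inarNoiseLaw lam a) :=
    fun k => (memLp_inarPath hlam ha k).sub (memLp_const _)
  have hUU : ∀ k l, Integrable (fun y => ((inarPath y k : ℝ) - lam / (1 - a)) *
      ((inarPath y l : ℝ) - lam / (1 - a))) (inarNoiseLaw lam a) :=
    fun k l => (hU k).integrable_mul (hU l)
  simp_rw [sq, Finset.sum_mul_sum]
  rw [integral_finsetSum _ fun k _ => integrable_finsetSum _ fun l _ => hUU k l]
  refine Finset.sum_congr rfl fun k _ => ?_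
  rw [integral_finsetSum _ fun l _ => hUU k l]
  exact Finset.sum_congr rfl fun l _ => integral_centred_mul_centred hlam ha k l

lemma lintegral_sq_sum_centred (hlam : 0 < lam) (ha : a ∈ Set.Ioo (0 : ℝ) 1) (s : Finset ℕ) :
    ∫⁻ y, ENNReal.ofReal ((∑ k ∈ s, ((inarPath y k : ℝ) - lam / (1 - a))) ^ 2)
      ∂(inarNoiseLaw lam a) =
      ENNReal.ofReal (∑ k ∈ s, ∑ l ∈ s, a ^ ((k - l) + (l - k)) * (lam / (1 - a))) := by
  rw [← integral_sq_sum_centred hlam ha, ofReal_integral_eq_lintegral_ofReal]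
  · exact (memLp_sum_centred hlam ha s).integrable_sq
  · exact .of_forall fun y => sq_nonneg _

/-- The crude bound, with every correlation replaced by 1. After division by `n ^ 2` it is uniform
in `n` and provides the dominating function in `a`. -/
lemma lintegral_sq_sum_centred_le_card_sq (hlam : 0 < lam) (ha : a ∈ Set.Ioo (0 : ℝ) 1)
    (s : Finset ℕ) :
    ∫⁻ y, ENNReal.ofReal ((∑ k ∈ s, ((inarPath y k : ℝ) - lam / (1 - a))) ^ 2)
      ∂(inarNoiseLaw lam a) ≤ ENNReal.ofReal ((s.card : ℝ) ^ 2 * (lam / (1 - a))) := by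
  have h1 : 0 < 1 - a := sub_pos.2 ha.2
  rw [lintegral_sq_sum_centred hlam ha]
  refine ENNReal.ofReal_le_ofReal ?_
  calc ∑ k ∈ s, ∑ l ∈ s, a ^ ((k - l) + (l - k)) * (lam / (1 - a))
      ≤ ∑ k ∈ s, ∑ l ∈ s, 1 * (lam / (1 - a)) := by
        gcongr
        exact pow_le_one₀ ha.1.le ha.2.le
    _ = (s.card : ℝ) ^ 2 * (lam / (1 - a)) := by simp; ring

/-- Summable correlations make the bound linear in the number of terms, which gives convergence to
zero for each fixed `a`. -/
lemma lintegral_sq_sum_centred_le_card (hlam : 0 < lam) (ha : a ∈ Set.Ioo (0 : ℝ) 1)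
    (s : Finset ℕ) :
    ∫⁻ y, ENNReal.ofReal ((∑ k ∈ s, ((inarPath y k : ℝ) - lam / (1 - a))) ^ 2)
      ∂(inarNoiseLaw lam a) ≤
        ENNReal.ofReal (s.card * (2 * (1 - a)⁻¹ * (lam / (1 - a)))) := by
  have h1 : 0 < 1 - a := sub_pos.2 ha.2
  rw [lintegral_sq_sum_centred hlam ha]
  refine ENNReal.ofReal_le_ofReal ?_
  simp_rw [← Finset.sum_mul]
  calc (∑ k ∈ s, ∑ l ∈ s, a ^ ((k - l) + (l - k))) * (lam / (1 - a))
      ≤ (∑ k ∈ s, 2 * (1 - a)⁻¹) * (lam / (1 - a)) := by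
        gcongr
        exact sum_pow_dist_le ha s _
    _ = _ := by simp; ring

end

/-! ### The mixing density and disintegration along the thinning parameter -/

section
variable {Ω : Type*} [MeasurableSpace Ω] {μ : Measure Ω}

lemma HasMixingDensity.ae_mem_Ioo {α : Ω → ℝ} {ψ : ℝ → ℝ} {β ψ₁ : ℝ}
    (h : HasMixingDensity μ α ψ β ψ₁) : ∀ᵐ a ∂(μ.map α), a ∈ Set.Ioo (0 : ℝ) 1 := by
  rw [h.law]
  exact (withDensity_absolutelyContinuous _ _).ae_le (ae_restrict_mem measurableSet_Ioo)

lemma lintegral_one_sub_rpow_lt_top {γ : ℝ} (hγ : -1 < γ) :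
    ∫⁻ x in Set.Ioo (0 : ℝ) 1, ENNReal.ofReal ((1 - x) ^ γ) < ∞ := by
  have h : IntervalIntegrable (fun x : ℝ => (1 - x) ^ γ) volume 0 1 := by
    have := (intervalIntegral.intervalIntegrable_rpow' (a := 0) (b := 1) hγ).comp_sub_left 1
    simpa using this.symm
  rw [intervalIntegrable_iff_integrableOn_Ioo_of_le zero_le_one] at h
  exact h.lintegral_lt_top

/-- Near 1 the function `ψ` is bounded and `(1 - x) ^ (β - 2)` is integrable since `β - 2 > -1`.
Away from 1 the factor `(1 - x)⁻¹ ^ 2` is bounded and the density has total mass one. -/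
lemma HasMixingDensity.lintegral_inv_sq_lt_top [IsProbabilityMeasure μ] {α : Ω → ℝ} {ψ : ℝ → ℝ}
    {β ψ₁ : ℝ} (h : HasMixingDensity μ α ψ β ψ₁) (hβ : 1 < β) :
    ∫⁻ a, ENNReal.ofReal ((1 - a)⁻¹ ^ 2) ∂(μ.map α) < ∞ := by
  have hprob : IsProbabilityMeasure (μ.map α) :=
    Measure.isProbabilityMeasure_map h.measurable.aemeasurable
  obtain ⟨c, hc, hψ⟩ : ∃ c < (1 : ℝ), ∀ x ∈ Set.Ioo c 1, ψ x ≤ ψ₁ + 1 :=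
    (mem_nhdsLT_iff_exists_Ioo_subset' zero_lt_one).1
      (h.tendsto_limit.eventually_le_const (lt_add_one ψ₁))
  have hc' : 0 < 1 - c := sub_pos.2 hc
  have hd : AEMeasurable (fun x => ENNReal.ofReal (ψ x * (1 - x) ^ β))
      (volume.restrict (Set.Ioo (0 : ℝ) 1)) :=
    (h.aemeasurable_density.mul (by fun_prop)).ennreal_ofReal
  have hone : ∫⁻ x in Set.Ioo (0 : ℝ) 1, ENNReal.ofReal (ψ x * (1 - x) ^ β) = 1 := by
    have := h.law ▸ measure_univ (μ := μ.map α)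
    rwa [withDensity_apply _ MeasurableSet.univ, Measure.restrict_univ] at this
  rw [h.law, lintegral_withDensity_eq_lintegral_mul₀ hd (by fun_prop)]
  have hψ1 := h.limit_pos
  calc _ ≤ ∫⁻ x in Set.Ioo (0 : ℝ) 1, (ENNReal.ofReal (ψ₁ + 1) * ENNReal.ofReal ((1 - x) ^ (β - 2)) +
        ENNReal.ofReal ((1 - c)⁻¹ ^ 2) * ENNReal.ofReal (ψ x * (1 - x) ^ β)) := by
        refine setLIntegral_mono_ae' measurableSet_Ioo (.of_forall fun x hx => ?_)
        have hx1 : 0 < 1 - x := sub_pos.2 hx.2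
        have h0 := h.density_nonneg x hx
        rw [Pi.mul_apply, ← ENNReal.ofReal_mul (by positivity), ← ENNReal.ofReal_mul (by positivity),
          ← ENNReal.ofReal_mul (by positivity), ← ENNReal.ofReal_add (by positivity) (by positivity)]
        refine ENNReal.ofReal_le_ofReal ?_
        rcases lt_or_ge c x with hcx | hcx
        · have e : (1 - x) ^ β * (1 - x)⁻¹ ^ 2 = (1 - x) ^ (β - 2) := by
            rw [Real.rpow_sub hx1, Real.rpow_two, inv_pow, div_eq_mul_inv]
          rw [mul_assoc, e]
          have := hψ x ⟨hcx, hx.2⟩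
          have : ψ x * (1 - x) ^ (β - 2) ≤ (ψ₁ + 1) * (1 - x) ^ (β - 2) := by gcongr
          have : 0 ≤ (1 - c)⁻¹ ^ 2 * (ψ x * (1 - x) ^ β) := by positivity
          linarith
        · have : (1 - x)⁻¹ ^ 2 ≤ (1 - c)⁻¹ ^ 2 := by gcongr
          have : ψ x * (1 - x) ^ β * (1 - x)⁻¹ ^ 2 ≤ ψ x * (1 - x) ^ β * (1 - c)⁻¹ ^ 2 := by gcongr
          have : 0 ≤ (ψ₁ + 1) * (1 - x) ^ (β - 2) := by positivity
          linarith
    _ < ∞ := by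
        rw [lintegral_add_left (by fun_prop), lintegral_const_mul _ (by fun_prop),
          lintegral_const_mul'' _ hd, hone]
        exact ENNReal.add_lt_top.2 ⟨ENNReal.mul_lt_top ENNReal.ofReal_lt_top
          (lintegral_one_sub_rpow_lt_top (by linarith)), by simp⟩

lemma HasMixingDensity.memLp_inv [IsProbabilityMeasure μ] {α : Ω → ℝ} {ψ : ℝ → ℝ} {β ψ₁ : ℝ}
    (h : HasMixingDensity μ α ψ β ψ₁) (hβ : 1 < β) : MemLp (fun ω => (1 - α ω)⁻¹) 2 μ := by
  have hα := h.measurable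
  have hm : Measurable fun ω => (1 - α ω)⁻¹ := by fun_prop
  rw [memLp_two_iff_integrable_sq hm.aestronglyMeasurable]
  refine ⟨(hm.pow_const 2).aestronglyMeasurable, ?_⟩
  rw [hasFiniteIntegral_iff_ofReal (.of_forall fun y => by positivity)]
  have := h.lintegral_inv_sq_lt_top hβ
  rwa [lintegral_map (by fun_prop) hα] at this

variable [IsProbabilityMeasure μ] {lam : ℝ} {α : ℕ → Ω → ℝ} {Y : ℕ → Ω → INARNoise}

lemma IsRandomizedINARFamily.lintegral_eq (hY : IsRandomizedINARFamily μ lam α Y) (j : ℕ)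
    {f : ℝ × INARNoise → ℝ≥0∞} (hf : Measurable f) :
    ∫⁻ ω, f (α j ω, Y j ω) ∂μ =
      ∫⁻ a, ∫⁻ y, f (a, y) ∂(condDistrib (Y j) (α j) μ a) ∂(μ.map (α j)) := by
  rw [← Measure.lintegral_compProd hf,
    compProd_map_condDistrib (hY.measurable_noise j).aemeasurable,
    lintegral_map hf ((hY.measurable_coeff j).prodMk (hY.measurable_noise j))]

lemma IsRandomizedINARFamily.lintegral_eq_of_cond (hY : IsRandomizedINARFamily μ lam α Y) (j : ℕ)
    (hα : ∀ᵐ a ∂(μ.map (α j)), a ∈ Set.Ioo (0 : ℝ) 1)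
    {f : ℝ × INARNoise → ℝ≥0∞} (hf : Measurable f) {g : ℝ → ℝ≥0∞} (hg : Measurable g)
    (hfg : ∀ a ∈ Set.Ioo (0 : ℝ) 1, ∫⁻ y, f (a, y) ∂(inarNoiseLaw lam a) = g a) :
    ∫⁻ ω, f (α j ω, Y j ω) ∂μ = ∫⁻ ω, g (α j ω) ∂μ := by
  rw [hY.lintegral_eq j hf, ← lintegral_map hg (hY.measurable_coeff j)]
  refine lintegral_congr_ae ?_
  filter_upwards [hα, hY.cond_law j] with a ha hl
  rw [hl, hfg a ha]

lemma IsRandomizedINARFamily.tendsto_lintegral_of_cond (hY : IsRandomizedINARFamily μ lam α Y)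
    (j : ℕ) (hα : ∀ᵐ a ∂(μ.map (α j)), a ∈ Set.Ioo (0 : ℝ) 1)
    {f : ℕ → ℝ × INARNoise → ℝ≥0∞} (hf : ∀ n, Measurable (f n)) {g : ℝ → ℝ≥0∞}
    (hfg : ∀ n, ∀ a ∈ Set.Ioo (0 : ℝ) 1, ∫⁻ y, f n (a, y) ∂(inarNoiseLaw lam a) ≤ g a)
    (hg : ∫⁻ a, g a ∂(μ.map (α j)) ≠ ∞)
    (hlim : ∀ a ∈ Set.Ioo (0 : ℝ) 1,
      Tendsto (fun n => ∫⁻ y, f n (a, y) ∂(inarNoiseLaw lam a)) atTop (𝓝 0)) :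
    Tendsto (fun n => ∫⁻ ω, f n (α j ω, Y j ω) ∂μ) atTop (𝓝 0) := by
  simp_rw [fun n => hY.lintegral_eq j (hf n)]
  rw [← lintegral_zero (μ := μ.map (α j))]
  refine tendsto_lintegral_of_dominated_convergence g
    (fun n => (hf n).lintegral_kernel_prod_right') (fun n => ?_) hg ?_
  · filter_upwards [hα, hY.cond_law j] with a ha hl
    rw [hl]
    exact hfg n a ha
  · filter_upwards [hα, hY.cond_law j] with a ha hl
    simpa [hl] using hlim a ha

/-- The joint law is determined by the law of the coefficient and the conditional kernel, and the
kernel is common to all copies. -/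
lemma IsRandomizedINARFamily.identDistrib (hY : IsRandomizedINARFamily μ lam α Y) {i j : ℕ}
    (h : μ.map (α i) = μ.map (α j)) :
    IdentDistrib (fun ω => (α i ω, Y i ω)) (fun ω => (α j ω, Y j ω)) μ μ where
  aemeasurable_fst := ((hY.measurable_coeff i).prodMk (hY.measurable_noise i)).aemeasurable
  aemeasurable_snd := ((hY.measurable_coeff j).prodMk (hY.measurable_noise j)).aemeasurable
  map_eq := by
    rw [← compProd_map_condDistrib (hY.measurable_noise i).aemeasurable,
      ← compProd_map_condDistrib (hY.measurable_noise j).aemeasurable, ← h]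
    refine Measure.compProd_congr ?_
    filter_upwards [hY.cond_law i, h ▸ hY.cond_law j] with a h1 h2
    rw [h1, h2]

end

/-! ### L² law of large numbers for one copy -/

section
variable {Ω : Type*} [MeasurableSpace Ω] {μ : Measure Ω} [IsProbabilityMeasure μ]
  {lam β ψ₁ : ℝ} {ψ : ℝ → ℝ} {α : ℕ → Ω → ℝ} {Y : ℕ → Ω → INARNoise}

lemma measurable_inarPath_noise (hY : IsRandomizedINARFamily μ lam α Y) (j k : ℕ) :
    Measurable fun ω => inarPath (Y j ω) k :=
  (measurable_inarPath k).comp (hY.measurable_noise j)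

lemma measurable_inarPath_noise_real (hY : IsRandomizedINARFamily μ lam α Y) (j k : ℕ) :
    Measurable fun ω => (inarPath (Y j ω) k : ℝ) :=
  measurable_from_top.comp (measurable_inarPath_noise hY j k)

lemma memLp_inarPath_noise (hlam : 0 < lam) (hβ : 1 < β) (hY : IsRandomizedINARFamily μ lam α Y)
    {j : ℕ} (hα : HasMixingDensity μ (α j) ψ β ψ₁) (k : ℕ) :
    MemLp (fun ω => (inarPath (Y j ω) k : ℝ)) 2 μ := by
  refine memLp_two_natCast_of_lintegral_sq_lt_top (measurable_inarPath_noise hY j k) ?_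
  have hm : Measurable fun p : ℝ × INARNoise => (inarPath p.2 k : ℝ≥0∞) ^ 2 :=
    (measurable_natCast_comp ((measurable_inarPath k).comp measurable_snd)).pow_const 2
  rw [hY.lintegral_eq_of_cond j hα.ae_mem_Ioo hm
    (g := fun a => ENNReal.ofReal ((lam / (1 - a)) ^ 2 + lam / (1 - a))) (by fun_prop)
    fun a ha => lintegral_inarPath_sq hlam ha k]
  have h := hα.memLp_inv hβ
  have hi : Integrable (fun ω => (lam * (1 - α j ω)⁻¹) ^ 2 + lam * (1 - α j ω)⁻¹) μ :=
    (h.const_mul lam).integrable_sq.add ((h.const_mul lam).integrable one_le_two)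
  simpa [div_eq_mul_inv] using hi.lintegral_lt_top

lemma integral_inarPath_noise (hlam : 0 < lam) (hY : IsRandomizedINARFamily μ lam α Y)
    {j : ℕ} (hα : HasMixingDensity μ (α j) ψ β ψ₁) (k : ℕ) :
    ∫ ω, (inarPath (Y j ω) k : ℝ) ∂μ = lam * ∫ ω, (1 - α j ω)⁻¹ ∂μ := by
  have hm : Measurable fun p : ℝ × INARNoise => (inarPath p.2 k : ℝ≥0∞) :=
    measurable_natCast_comp ((measurable_inarPath k).comp measurable_snd)
  have hαm := hY.measurable_coeff j
  have hpos : ∀ᵐ ω ∂μ, 0 ≤ lam * (1 - α j ω)⁻¹ := by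
    filter_upwards [ae_of_ae_map hαm.aemeasurable hα.ae_mem_Ioo] with ω h
    have := sub_pos.2 h.2
    positivity
  rw [← integral_const_mul, integral_eq_lintegral_of_nonneg_ae (.of_forall fun y => by positivity)
    (measurable_inarPath_noise_real hY j k).aestronglyMeasurable,
    integral_eq_lintegral_of_nonneg_ae hpos (by fun_prop), lintegral_ofReal_natCast,
    hY.lintegral_eq_of_cond j hα.ae_mem_Ioo hm
    (g := fun a => ENNReal.ofReal (lam * (1 - a)⁻¹)) (by fun_prop)
    fun a ha => by rw [lintegral_inarPath hlam ha, div_eq_mul_inv]]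

omit [IsProbabilityMeasure μ] in
lemma eLpNorm_two_eq_lintegral_ofReal_sq (f : Ω → ℝ) :
    eLpNorm f 2 μ = (∫⁻ ω, ENNReal.ofReal (f ω ^ 2) ∂μ) ^ (1 / 2 : ℝ) := by
  rw [eLpNorm_eq_lintegral_rpow_enorm_toReal two_ne_zero ENNReal.ofNat_ne_top]
  simp only [ENNReal.toReal_ofNat, ENNReal.rpow_two]
  congr 2
  ext ω
  rw [← sq_abs, ENNReal.ofReal_pow (abs_nonneg _), Real.enorm_eq_ofReal_abs]

lemma measurable_sum_sub_conditional_mean (s : Finset ℕ) (n : ℕ) :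
    Measurable fun p : ℝ × INARNoise =>
      (n : ℝ)⁻¹ * ∑ k ∈ s, ((inarPath p.2 k : ℝ) - lam / (1 - p.1)) := by
  have : ∀ k, Measurable fun p : ℝ × INARNoise => (inarPath p.2 k : ℝ) := fun k =>
    (measurable_inarPath_real k).comp measurable_snd
  fun_prop

/-- Dominated convergence over the law of `α j`: the linear bound gives the limit for fixed `a`, and
the quadratic bound gives the integrable majorant. -/
lemma tendsto_eLpNorm_conditional_mean (hlam : 0 < lam) (hβ : 1 < β)
    (hY : IsRandomizedINARFamily μ lam α Y) {j : ℕ} (hα : HasMixingDensity μ (α j) ψ β ψ₁)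
    (t : ℝ≥0) :
    Tendsto (fun n : ℕ => eLpNorm (fun ω => (n : ℝ)⁻¹ * ∑ k ∈ Finset.Icc 1 ⌊(n : ℝ) * t⌋₊,
      ((inarPath (Y j ω) k : ℝ) - lam / (1 - α j ω))) 2 μ) atTop (𝓝 0) := by
  have hprob : IsProbabilityMeasure (μ.map (α j)) :=
    Measure.isProbabilityMeasure_map hα.measurable.aemeasurable
  have hfloor : ∀ n : ℕ, ((Finset.Icc 1 ⌊(n : ℝ) * t⌋₊).card : ℝ) ≤ n * t := fun n => by
    simpa using Nat.floor_le (by positivity : 0 ≤ (n : ℝ) * t)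
  simp_rw [eLpNorm_two_eq_lintegral_ofReal_sq]
  suffices h : Tendsto (fun n : ℕ => ∫⁻ ω, ENNReal.ofReal (((n : ℝ)⁻¹ *
      ∑ k ∈ Finset.Icc 1 ⌊(n : ℝ) * t⌋₊, ((inarPath (Y j ω) k : ℝ) - lam / (1 - α j ω))) ^ 2) ∂μ)
      atTop (𝓝 0) by
    simpa using h.ennrpow_const (1 / 2)
  have hle : ∀ (n : ℕ) (a : ℝ), ∫⁻ y, ENNReal.ofReal (((n : ℝ)⁻¹ *
      ∑ k ∈ Finset.Icc 1 ⌊(n : ℝ) * t⌋₊, ((inarPath y k : ℝ) - lam / (1 - a))) ^ 2)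
        ∂(inarNoiseLaw lam a) = ENNReal.ofReal ((n : ℝ)⁻¹ ^ 2) *
      ∫⁻ y, ENNReal.ofReal ((∑ k ∈ Finset.Icc 1 ⌊(n : ℝ) * t⌋₊,
        ((inarPath y k : ℝ) - lam / (1 - a))) ^ 2) ∂(inarNoiseLaw lam a) := by
    intro n a
    rw [← lintegral_const_mul' _ _ ENNReal.ofReal_ne_top]
    refine lintegral_congr fun y => ?_
    rw [mul_pow, ENNReal.ofReal_mul (by positivity)]
  refine hY.tendsto_lintegral_of_cond j hα.ae_mem_Ioo
    (f := fun n p => ENNReal.ofReal (((n : ℝ)⁻¹ * ∑ k ∈ Finset.Icc 1 ⌊(n : ℝ) * t⌋₊,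
      ((inarPath p.2 k : ℝ) - lam / (1 - p.1))) ^ 2))
    (fun n => ((measurable_sum_sub_conditional_mean _ n).pow_const 2).ennreal_ofReal)
    -- The majorant comes from `n⁻² (nt)² lam / (1 - a)`.
    (g := fun a => ENNReal.ofReal ((t : ℝ) ^ 2 * lam * (1 - a)⁻¹)) ?_ ?_ ?_
  · intro n a ha
    have h1 := sub_pos.2 ha.2
    simp only [hle]
    refine (mul_le_mul_right (lintegral_sq_sum_centred_le_card_sq hlam ha _) _).trans ?_
    rw [← ENNReal.ofReal_mul (by positivity)]
    refine ENNReal.ofReal_le_ofReal ?_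
    rcases Nat.eq_zero_or_pos n with rfl | hn
    · simp; positivity
    calc (n : ℝ)⁻¹ ^ 2 * (((Finset.Icc 1 ⌊(n : ℝ) * t⌋₊).card : ℝ) ^ 2 * (lam / (1 - a)))
        ≤ (n : ℝ)⁻¹ ^ 2 * ((n * t) ^ 2 * (lam / (1 - a))) := by gcongr; exact hfloor n
      _ = _ := by field_simp
  · have h := ((hα.memLp_inv hβ).integrable one_le_two).const_mul ((t : ℝ) ^ 2 * lam)
    rw [lintegral_map (by fun_prop) hα.measurable]
    exact h.lintegral_lt_top.ne
  · intro a ha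
    have h1 := sub_pos.2 ha.2
    simp only [hle]
    have hb : Tendsto (fun n : ℕ => ENNReal.ofReal
        ((n : ℝ)⁻¹ * (t * (2 * (1 - a)⁻¹ * (lam / (1 - a)))))) atTop (𝓝 0) := by
      simpa using ENNReal.tendsto_ofReal
        ((tendsto_inv_atTop_nhds_zero_nat (𝕜 := ℝ)).mul_const (t * (2 * (1 - a)⁻¹ * (lam / (1 - a)))))
    refine tendsto_of_tendsto_of_tendsto_of_le_of_le tendsto_const_nhds hb
      (fun _ => zero_le) fun n => ?_
    refine (mul_le_mul_right (lintegral_sq_sum_centred_le_card hlam ha _) _).trans ?_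
    rw [← ENNReal.ofReal_mul (by positivity)]
    refine ENNReal.ofReal_le_ofReal ?_
    rcases Nat.eq_zero_or_pos n with rfl | hn
    · simp
    calc (n : ℝ)⁻¹ ^ 2 * ((Finset.Icc 1 ⌊(n : ℝ) * t⌋₊).card * (2 * (1 - a)⁻¹ * (lam / (1 - a))))
        ≤ (n : ℝ)⁻¹ ^ 2 * ((n * t) * (2 * (1 - a)⁻¹ * (lam / (1 - a)))) := by
          gcongr; exact hfloor n
      _ = _ := by field_simp

/-- The centred conditional mean of the path given the thinning parameter. -/
noncomputable def centredConditionalMean (μ : Measure Ω) (lam : ℝ) (α : ℕ → Ω → ℝ) (j : ℕ)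
    (ω : Ω) : ℝ :=
  lam * ((1 - α j ω)⁻¹ - ∫ ω', (1 - α j ω')⁻¹ ∂μ)

lemma memLp_centredConditionalMean (hβ : 1 < β) {j : ℕ}
    (hα : HasMixingDensity μ (α j) ψ β ψ₁) : MemLp (centredConditionalMean μ lam α j) 2 μ :=
  ((hα.memLp_inv hβ).sub (memLp_const _)).const_mul lam

lemma memLp_sum_sub_mean (hlam : 0 < lam) (hβ : 1 < β) (hY : IsRandomizedINARFamily μ lam α Y)
    {j : ℕ} (hα : HasMixingDensity μ (α j) ψ β ψ₁) (s : Finset ℕ) (c : ℝ) :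
    MemLp (fun ω => c * ∑ k ∈ s,
      ((inarPath (Y j ω) k : ℝ) - ∫ ω', (inarPath (Y j ω') k : ℝ) ∂μ)) 2 μ :=
  (memLp_finsetSum _ fun k _ =>
    (memLp_inarPath_noise hlam hβ hY hα k).sub (memLp_const _)).const_mul c

lemma tendsto_floor_mul_div (t : ℝ≥0) :
    Tendsto (fun n : ℕ => (n : ℝ)⁻¹ * ⌊(n : ℝ) * t⌋₊) atTop (𝓝 t) := by
  have := (tendsto_nat_floor_mul_div_atTop (R := ℝ) t.2).comp tendsto_natCast_atTop_atTop
  refine this.congr fun n => ?_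
  simp [div_eq_inv_mul, mul_comm]

lemma tendsto_eLpNorm_average (hlam : 0 < lam) (hβ : 1 < β)
    (hY : IsRandomizedINARFamily μ lam α Y) {j : ℕ} (hα : HasMixingDensity μ (α j) ψ β ψ₁)
    (t : ℝ≥0) :
    Tendsto (fun n : ℕ => eLpNorm (fun ω => (n : ℝ)⁻¹ * ∑ k ∈ Finset.Icc 1 ⌊(n : ℝ) * t⌋₊,
      ((inarPath (Y j ω) k : ℝ) - ∫ ω', (inarPath (Y j ω') k : ℝ) ∂μ) -
        t * centredConditionalMean μ lam α j ω) 2 μ) atTop (𝓝 0) := by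
  have h1 := tendsto_eLpNorm_conditional_mean hlam hβ hY hα t
  have h2 : Tendsto (fun n : ℕ => eLpNorm (fun ω => ((n : ℝ)⁻¹ * ⌊(n : ℝ) * t⌋₊ - t) *
      centredConditionalMean μ lam α j ω) 2 μ) atTop (𝓝 0) := by
    have e : ∀ c : ℝ, eLpNorm (fun ω => c * centredConditionalMean μ lam α j ω) 2 μ =
        ‖c‖ₑ * eLpNorm (centredConditionalMean μ lam α j) 2 μ := fun c =>
      eLpNorm_const_smul c _ _ _
    simp_rw [e]
    have h0 : Tendsto (fun n : ℕ => ‖(n : ℝ)⁻¹ * ⌊(n : ℝ) * t⌋₊ - t‖ₑ) atTop (𝓝 0) := by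
      simpa using ((tendsto_floor_mul_div t).sub_const (t : ℝ)).enorm
    simpa using ENNReal.Tendsto.mul_const h0
      (Or.inr (memLp_centredConditionalMean (lam := lam) hβ hα).eLpNorm_ne_top)
  have h12 := h1.add h2
  rw [add_zero] at h12
  refine tendsto_of_tendsto_of_tendsto_of_le_of_le tendsto_const_nhds h12
    (fun _ => zero_le) fun n => ?_
  -- Recentring at the conditional mean leaves `⌊nt⌋` equal terms, so the error splits into a
  -- conditional fluctuation and a rounding error.
  have e : (fun ω => (n : ℝ)⁻¹ * ∑ k ∈ Finset.Icc 1 ⌊(n : ℝ) * t⌋₊,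
      ((inarPath (Y j ω) k : ℝ) - ∫ ω', (inarPath (Y j ω') k : ℝ) ∂μ) -
        t * centredConditionalMean μ lam α j ω) =
      (fun ω => (n : ℝ)⁻¹ * ∑ k ∈ Finset.Icc 1 ⌊(n : ℝ) * t⌋₊,
        ((inarPath (Y j ω) k : ℝ) - lam / (1 - α j ω))) +
      fun ω => ((n : ℝ)⁻¹ * ⌊(n : ℝ) * t⌋₊ - t) * centredConditionalMean μ lam α j ω := by
    ext ω
    simp only [Pi.add_apply, integral_inarPath_noise hlam hY hα, Finset.sum_sub_distrib,
      Finset.sum_const, Nat.card_Icc, add_tsub_cancel_right, nsmul_eq_mul, centredConditionalMean]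
    ring
  rw [e]
  refine eLpNorm_add_le ?_ ?_ one_le_two
  · exact ((measurable_sum_sub_conditional_mean _ n).comp
      ((hY.measurable_coeff j).prodMk (hY.measurable_noise j))).aestronglyMeasurable
  · exact ((memLp_centredConditionalMean hβ hα).const_mul _).aestronglyMeasurable

end

/-! ### Finite-dimensional convergence through characteristic functions -/

lemma charFun_map_toLp_eq {ι Ω : Type*} [Fintype ι] [MeasurableSpace Ω] {μ : Measure Ω}
    {Z : Ω → ι → ℝ} (hZ : AEMeasurable Z μ) (θ : EuclideanSpace ℝ ι) :
    charFun (μ.map fun ω => WithLp.toLp 2 (Z ω)) θ =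
      charFun (μ.map fun ω => ∑ i, θ i * Z ω i) 1 := by
  have h1 : AEMeasurable (fun ω => WithLp.toLp 2 (Z ω)) μ := by fun_prop
  have h2 : AEMeasurable (fun ω => ∑ i, θ i * Z ω i) μ := by fun_prop
  rw [charFun_apply, charFun_apply, integral_map h1 (by fun_prop), integral_map h2 (by fun_prop)]
  simp [PiLp.inner_apply]

/-- **Cramér–Wold device**, in terms of characteristic functions. -/
lemma tendstoInDistribution_pi_of_tendsto_charFun {ι : Type*} [Fintype ι] {Ω : ℕ → Type*}
    [∀ m, MeasurableSpace (Ω m)] {μ : ∀ m, Measure (Ω m)} [∀ m, IsProbabilityMeasure (μ m)]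
    {Ω' : Type*} [MeasurableSpace Ω'] {ν : Measure Ω'} [IsProbabilityMeasure ν]
    {Z : ∀ m, Ω m → ι → ℝ} {V : Ω' → ι → ℝ} (hZ : ∀ m, AEMeasurable (Z m) (μ m))
    (hV : AEMeasurable V ν)
    (h : ∀ θ : ι → ℝ, Tendsto (fun m => charFun ((μ m).map fun ω => ∑ i, θ i * Z m ω i) 1) atTop
      (𝓝 (charFun (ν.map fun ω => ∑ i, θ i * V ω i) 1))) :
    TendstoInDistribution Z atTop V μ ν := by
  have hE : TendstoInDistribution (fun m ω => WithLp.toLp 2 (Z m ω)) atTop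
      (fun ω => WithLp.toLp 2 (V ω)) μ ν := by
    refine ⟨fun m => by have := hZ m; fun_prop, by fun_prop, ?_⟩
    refine ProbabilityMeasure.tendsto_iff_tendsto_charFun.2 fun θ => ?_
    simp only [ProbabilityMeasure.coe_mk, charFun_map_toLp_eq hV, fun m => charFun_map_toLp_eq (hZ m)]
    exact h θ
  exact hE.continuous_comp (g := WithLp.ofLp) (PiLp.continuous_ofLp 2 _)

lemma tendsto_charFun_map_of_tendstoInDistribution {Ω : ℕ → Type*}
    [∀ m, MeasurableSpace (Ω m)] {μ : ∀ m, Measure (Ω m)} [∀ m, IsProbabilityMeasure (μ m)]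
    {Ω' : Type*} [MeasurableSpace Ω'] {ν : Measure Ω'} [IsProbabilityMeasure ν]
    {Z : ∀ m, Ω m → ℝ} {V : Ω' → ℝ} (h : TendstoInDistribution Z atTop V μ ν) (t : ℝ) :
    Tendsto (fun m => charFun ((μ m).map (Z m)) t) atTop (𝓝 (charFun (ν.map V) t)) :=
  ProbabilityMeasure.tendsto_iff_tendsto_charFun.1 h.tendsto t

section
variable {Ω : ℕ → Type*} [∀ m, MeasurableSpace (Ω m)] {μ : ∀ m, Measure (Ω m)}
  [∀ m, IsProbabilityMeasure (μ m)] {Ω' : Type*} [MeasurableSpace Ω'] {ν : Measure Ω'}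
  [IsProbabilityMeasure ν] {Z : ∀ m, ℝ≥0 → Ω m → ℝ} {V : ℝ≥0 → Ω' → ℝ}

lemma fddTendsto_of_tendsto_charFun (hZ : ∀ m t, AEMeasurable (Z m t) (μ m))
    (hV : ∀ t, AEMeasurable (V t) ν)
    (h : ∀ (I : Finset ℝ≥0) (θ : I → ℝ),
      Tendsto (fun m => charFun ((μ m).map fun ω => ∑ t, θ t * Z m t ω) 1) atTop
        (𝓝 (charFun (ν.map fun ω => ∑ t, θ t * V t ω) 1))) : FddTendsto Z μ V ν := fun I =>
  tendstoInDistribution_pi_of_tendsto_charFun (fun m => aemeasurable_pi_lambda _ fun t => hZ m t)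
    (aemeasurable_pi_lambda _ fun t => hV t) (h I)

end

/-! ### Gaussian sequences with a prescribed Gram matrix -/

section
variable {H : Type*} [NormedAddCommGroup H] [InnerProductSpace ℝ H]

lemma inner_gramSchmidtNormed_eq_zero_of_ne (f : ℕ → H) {i j : ℕ} (h : i ≠ j) :
    inner ℝ (InnerProductSpace.gramSchmidtNormed ℝ f i)
      (InnerProductSpace.gramSchmidtNormed ℝ f j) = 0 := by
  simp [InnerProductSpace.gramSchmidtNormed, inner_smul_left, inner_smul_right,
    InnerProductSpace.gramSchmidt_orthogonal ℝ f h]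

/-- The normalized Gram–Schmidt family is orthonormal up to zero vectors. The zero vectors do no
harm, so `f` may be linearly dependent. -/
lemma sum_inner_gramSchmidtNormed_smul (f : ℕ → H) {M : ℕ} {v : H}
    (hv : v ∈ Submodule.span ℝ (f '' Set.Iio M)) :
    ∑ i ∈ Finset.range M, inner ℝ (InnerProductSpace.gramSchmidtNormed ℝ f i) v •
      InnerProductSpace.gramSchmidtNormed ℝ f i = v := by
  rw [← InnerProductSpace.span_gramSchmidt_Iio,
    ← InnerProductSpace.span_gramSchmidtNormed] at hv
  induction hv using Submodule.span_induction with
  | mem x hx =>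
    obtain ⟨j, hj, rfl⟩ := hx
    rw [Finset.sum_eq_single_of_mem j (Finset.mem_range.2 hj)
      fun i _ hij => by rw [inner_gramSchmidtNormed_eq_zero_of_ne f hij, zero_smul]]
    by_cases h : InnerProductSpace.gramSchmidtNormed ℝ f j = 0
    · simp [h]
    · simp [InnerProductSpace.gramSchmidtNormed_unit_length' h]
  | zero => simp
  | add x y _ _ hx hy =>
    simp_rw [inner_add_right, add_smul, Finset.sum_add_distrib, hx, hy]
  | smul c x _ hx =>
    simp_rw [inner_smul_right, mul_smul, ← Finset.smul_sum, hx]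

lemma sum_sq_inner_gramSchmidtNormed (f : ℕ → H) {M : ℕ} {v : H}
    (hv : v ∈ Submodule.span ℝ (f '' Set.Iio M)) :
    ∑ i ∈ Finset.range M, inner ℝ (InnerProductSpace.gramSchmidtNormed ℝ f i) v ^ 2 =
      ‖v‖ ^ 2 := by
  conv_rhs => rw [← real_inner_self_eq_norm_sq, ← sum_inner_gramSchmidtNormed_smul f hv]
  rw [sum_inner]
  refine Finset.sum_congr rfl fun i _ => ?_
  rw [inner_smul_left, sum_inner_gramSchmidtNormed_smul f hv, sq]
  simp

/-- Triangularity: `f k` lies in the span of the Gram–Schmidt vectors with index below `i`. Hence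
each Gaussian coordinate is a finite sum. -/
lemma inner_gramSchmidtNormed_eq_zero_of_lt (f : ℕ → H) {i k : ℕ} (h : k < i) :
    inner ℝ (InnerProductSpace.gramSchmidtNormed ℝ f i) (f k) = 0 := by
  rw [← sum_inner_gramSchmidtNormed_smul f (M := i) (v := f k)
    (Submodule.subset_span ⟨k, h, rfl⟩), inner_sum]
  refine Finset.sum_eq_zero fun j hj => ?_
  rw [inner_smul_right, inner_gramSchmidtNormed_eq_zero_of_ne f (Finset.mem_range.1 hj).ne', mul_zero]

lemma map_sum_mul_infinitePi_gaussianReal (b : ℕ → ℝ) (M : ℕ) :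
    (Measure.infinitePi fun _ : ℕ => gaussianReal 0 1).map
        (fun w => ∑ i ∈ Finset.range M, b i * w i) =
      gaussianReal 0 (∑ i ∈ Finset.range M, b i ^ 2).toNNReal := by
  have hind : iIndepFun (fun i (w : ℕ → ℝ) => b i * w i)
      (Measure.infinitePi fun _ : ℕ => gaussianReal 0 1) :=
    iIndepFun_infinitePi (X := fun i x => b i * x) fun i => by fun_prop
  have hm : ∀ i, Measurable fun w : ℕ → ℝ => b i * w i := fun i => by fun_prop
  apply Measure.ext_of_charFun
  ext t
  rw [(hind.restrict (Finset.range M)).charFun_map_fun_finsetSum_eq_prod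
    (fun i _ => (hm _).aemeasurable), charFun_gaussianReal]
  have : ∀ i, charFun ((Measure.infinitePi fun _ : ℕ => gaussianReal 0 1).map
      fun w : ℕ → ℝ => b i * w i) t = Complex.exp (-(b i ^ 2 * t ^ 2 / 2)) := fun i => by
    rw [charFun_map_mul_comp (measurable_pi_apply i).aemeasurable, Measure.infinitePi_map_eval, charFun_gaussianReal]
    congr 1
    push_cast
    ring
  rw [Finset.prod_apply, Finset.prod_congr rfl fun i _ => this i, ← Complex.exp_sum]
  congr 1
  rw [Real.coe_toNNReal _ (by positivity)]
  push_cast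
  simp [Finset.sum_mul, Finset.sum_div]

/-- A centred Gaussian sequence whose covariances are the inner products of the `f k`. -/
lemma exists_gaussian_sequence (f : ℕ → H) :
    ∃ P : ProbabilityMeasure (ℕ → ℝ), ∀ (s : Finset ℕ) (c : ℕ → ℝ),
      (P : Measure (ℕ → ℝ)).map (fun w => ∑ k ∈ s, c k * w k) =
        gaussianReal 0 (‖∑ k ∈ s, c k • f k‖ ^ 2).toNNReal := by
  set e := InnerProductSpace.gramSchmidtNormed ℝ f
  -- The `k`-th variable is the expansion of `f k` with the orthonormal directions replaced by
  -- independent standard normals.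
  have hG : Measurable fun (w : ℕ → ℝ) k => ∑ i ∈ Finset.range (k + 1), inner ℝ (e i) (f k) * w i := by
    fun_prop
  refine ⟨⟨(Measure.infinitePi fun _ : ℕ => gaussianReal 0 1).map _,
    Measure.isProbabilityMeasure_map hG.aemeasurable⟩, fun s c => ?_⟩
  obtain ⟨M, hM⟩ : ∃ M, ∀ k ∈ s, k < M := ⟨s.sup id + 1, fun k hk =>
    Nat.lt_succ_of_le (Finset.le_sup (f := id) hk)⟩
  set v := ∑ k ∈ s, c k • f k with hv
  have hmem : v ∈ Submodule.span ℝ (f '' Set.Iio M) := Submodule.sum_mem _ fun k hk =>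
    Submodule.smul_mem _ _ (Submodule.subset_span ⟨k, hM k hk, rfl⟩)
  rw [ProbabilityMeasure.coe_mk, Measure.map_map (by fun_prop) hG,
    ← sum_sq_inner_gramSchmidtNormed f hmem, ← map_sum_mul_infinitePi_gaussianReal]
  congr 1
  ext w
  -- By triangularity all expansions can share the range `M`, so the sums over `i` and `k` may be
  -- interchanged.
  have hk : ∀ k ∈ s, ∑ i ∈ Finset.range (k + 1), inner ℝ (e i) (f k) * w i =
      ∑ i ∈ Finset.range M, inner ℝ (e i) (f k) * w i := fun k hk => by
    refine Finset.sum_subset (by simpa using hM k hk) fun i _ hi => ?_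
    rw [inner_gramSchmidtNormed_eq_zero_of_lt f (by simpa using hi), zero_mul]
  change ∑ k ∈ s, c k * ∑ i ∈ Finset.range (k + 1), inner ℝ (e i) (f k) * w i = _
  rw [Finset.sum_congr rfl fun k hks => congrArg (c k * ·) (hk k hks)]
  simp_rw [Finset.mul_sum]
  rw [Finset.sum_comm]
  refine Finset.sum_congr rfl fun i _ => ?_
  rw [hv, inner_sum, Finset.sum_mul]
  refine Finset.sum_congr rfl fun k _ => ?_
  rw [inner_smul_right, mul_assoc]

end

/-- Turns a combination of partial sums into a combination of single terms. The coefficients do not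
depend on `g`, so the same ones serve for Gaussian variables and for L² vectors. -/
lemma sum_smul_sum_eq_sum_biUnion {ι E : Type*} [Fintype ι] [AddCommGroup E] [Module ℝ E]
    (θ : ι → ℝ) (s : ι → Finset ℕ) (g : ℕ → E) :
    ∑ t, θ t • ∑ k ∈ s t, g k =
      ∑ k ∈ Finset.univ.biUnion s, (∑ t, if k ∈ s t then θ t else 0) • g k := by
  simp_rw [Finset.sum_smul, Finset.smul_sum, ite_smul, zero_smul]
  rw [Finset.sum_comm]
  refine Finset.sum_congr rfl fun t _ => ?_
  rw [← Finset.sum_filter]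
  refine Finset.sum_congr ?_ fun _ _ => rfl
  ext k
  simp only [Finset.mem_filter, Finset.mem_biUnion, Finset.mem_univ, true_and]
  exact ⟨fun h => ⟨⟨t, h⟩, h⟩, fun h => h.2⟩

/-! ### The central limit theorem in terms of L² norms -/

section
variable {Ω : Type*} [MeasurableSpace Ω] {μ : Measure Ω}

lemma norm_toLp_two_sq {f : Ω → ℝ} (hf : MemLp f 2 μ) : ‖hf.toLp f‖ ^ 2 = ∫ ω, f ω ^ 2 ∂μ := by
  rw [Lp.norm_toLp, eLpNorm_two_eq_lintegral_ofReal_sq, ← ENNReal.toReal_pow, ← ENNReal.rpow_two,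
    ← ENNReal.rpow_mul, integral_eq_lintegral_of_nonneg_ae (.of_forall fun ω => sq_nonneg _)
    (hf.integrable_sq.aestronglyMeasurable)]
  norm_num

lemma memLp_finsetSum_mul {ι : Type*} (s : Finset ι) (c : ι → ℝ) {g : ι → Ω → ℝ}
    (hg : ∀ i, MemLp (g i) 2 μ) : MemLp (fun ω => ∑ i ∈ s, c i * g i ω) 2 μ :=
  memLp_finsetSum s fun i _ => (hg i).const_mul (c i)

lemma toLp_finsetSum_mul {ι : Type*} (s : Finset ι) (c : ι → ℝ) {g : ι → Ω → ℝ}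
    (hg : ∀ i, MemLp (g i) 2 μ) :
    (memLp_finsetSum_mul s c hg).toLp (fun ω => ∑ i ∈ s, c i * g i ω) =
      ∑ i ∈ s, c i • (hg i).toLp (g i) := by
  classical
  induction s using Finset.induction_on with
  | empty => exact MemLp.toLp_zero _
  | insert i s hi ih =>
    rw [Finset.sum_insert hi, ← ih, ← MemLp.toLp_const_smul, ← MemLp.toLp_add]
    congr 1
    ext ω
    simp [Finset.sum_insert hi]

variable [IsProbabilityMeasure μ]

/-- The variance is recorded as a squared L² norm so that its later convergence is continuity of the
norm. -/
lemma tendsto_charFun_inv_sqrt_mul_sum {B : ℕ → Ω → ℝ} (hB : MemLp (B 0) 2 μ)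
    (h0 : μ[B 0] = 0) (hindep : iIndepFun B μ) (hident : ∀ i, IdentDistrib (B i) (B 0) μ μ) :
    Tendsto (fun N : ℕ => charFun (μ.map fun ω => (√N)⁻¹ * ∑ j ∈ Finset.range N, B j ω) 1) atTop
      (𝓝 (charFun (gaussianReal 0 (‖hB.toLp (B 0)‖ ^ 2).toNNReal) 1)) := by
  have hvar : Var[B 0; μ] = ‖hB.toLp (B 0)‖ ^ 2 := by
    rw [norm_toLp_two_sq, variance_of_integral_eq_zero hB.aemeasurable h0]
  have h := tendsto_charFun_map_of_tendstoInDistribution (tendstoInDistribution_inv_sqrt_mul_sum_sub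
    (Y := id) (P' := gaussianReal 0 (‖hB.toLp (B 0)‖ ^ 2).toNNReal)
    (by rw [hvar]; exact HasLaw.id) hB hindep hident) 1
  simpa [h0] using h

lemma tendsto_charFun_of_tendsto_toLp {f : ℕ → Ω → ℝ} {g : Ω → ℝ} (hf : ∀ n, MemLp (f n) 2 μ)
    (hg : MemLp g 2 μ) (h : Tendsto (fun n => (hf n).toLp (f n)) atTop (𝓝 (hg.toLp g))) (t : ℝ) :
    Tendsto (fun n => charFun (μ.map (f n)) t) atTop (𝓝 (charFun (μ.map g) t)) :=
  tendsto_charFun_map_of_tendstoInDistribution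
    ((tendstoInMeasure_of_tendsto_eLpNorm two_ne_zero (fun n => (hf n).aestronglyMeasurable)
      hg.aestronglyMeasurable ((Lp.tendsto_Lp_iff_tendsto_eLpNorm'' f hf g hg).1 h)).tendstoInDistribution
        fun n => (hf n).aemeasurable) t

lemma tendsto_charFun_gaussianReal {v : ℕ → ℝ} {v₀ : ℝ} (h : Tendsto v atTop (𝓝 v₀)) (t : ℝ) :
    Tendsto (fun n => charFun (gaussianReal 0 (v n).toNNReal) t) atTop
      (𝓝 (charFun (gaussianReal 0 v₀.toNNReal) t)) := by
  simp_rw [charFun_gaussianReal]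
  have h1 : Tendsto (fun n => ((v n).toNNReal : ℝ)) atTop (𝓝 (v₀.toNNReal : ℝ)) :=
    NNReal.tendsto_coe.2 ((continuous_real_toNNReal.tendsto v₀).comp h)
  have h2 := (Complex.continuous_ofReal.tendsto _).comp h1
  exact (Complex.continuous_exp.tendsto _).comp
    (((h2.mul_const _).div_const _).const_sub _)

end

/-! ### The two iterated limits -/

section
variable {Ω : Type*} [MeasurableSpace Ω] {μ : Measure Ω} [IsProbabilityMeasure μ]
  {lam β ψ₁ : ℝ} {ψ : ℝ → ℝ} {α : ℕ → Ω → ℝ} {Y : ℕ → Ω → INARNoise}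

/-- The time average up to `⌊nt⌋` of a single centred copy. -/
noncomputable def centredAverage (μ : Measure Ω) (Y : ℕ → Ω → INARNoise) (n : ℕ) (t : ℝ≥0) (j : ℕ)
    (ω : Ω) : ℝ :=
  (n : ℝ)⁻¹ * ∑ k ∈ Finset.Icc 1 ⌊(n : ℝ) * t⌋₊,
    ((inarPath (Y j ω) k : ℝ) - ∫ ω', (inarPath (Y j ω') k : ℝ) ∂μ)

omit [IsProbabilityMeasure μ] in
lemma scaled_aggregatedSum_eq (N n : ℕ) (t : ℝ≥0) (ω : Ω) :
    (n : ℝ)⁻¹ * (N : ℝ) ^ (-(1 / 2) : ℝ) * aggregatedSum μ Y N n t ω =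
      (√N)⁻¹ * ∑ j ∈ Finset.range N, centredAverage μ Y n t j ω := by
  rw [Real.rpow_neg N.cast_nonneg, ← Real.sqrt_eq_rpow, aggregatedSum]
  simp_rw [centredAverage, ← Finset.mul_sum]
  ring

omit [IsProbabilityMeasure μ] in
lemma sum_mul_scaled_aggregatedSum {ι : Type*} [Fintype ι] (θ : ι → ℝ) (τ : ι → ℝ≥0) (N n : ℕ)
    (ω : Ω) :
    ∑ t, θ t * ((n : ℝ)⁻¹ * (N : ℝ) ^ (-(1 / 2) : ℝ) * aggregatedSum μ Y N n (τ t) ω) =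
      (√N)⁻¹ * ∑ j ∈ Finset.range N, ∑ t, θ t * centredAverage μ Y n (τ t) j ω := by
  simp_rw [scaled_aggregatedSum_eq]
  rw [Finset.sum_comm, Finset.mul_sum]
  refine Finset.sum_congr rfl fun t _ => ?_
  rw [← Finset.mul_sum]
  ring

lemma memLp_centredAverage (hlam : 0 < lam) (hβ : 1 < β) (hY : IsRandomizedINARFamily μ lam α Y)
    (hα : ∀ j, HasMixingDensity μ (α j) ψ β ψ₁) (n : ℕ) (t : ℝ≥0) (j : ℕ) :
    MemLp (centredAverage μ Y n t j) 2 μ :=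
  memLp_sum_sub_mean hlam hβ hY (hα j) _ _

lemma tendsto_toLp_centredAverage (hlam : 0 < lam) (hβ : 1 < β)
    (hY : IsRandomizedINARFamily μ lam α Y) (hα : ∀ j, HasMixingDensity μ (α j) ψ β ψ₁) (t : ℝ≥0)
    (j : ℕ) :
    Tendsto (fun n => (memLp_centredAverage hlam hβ hY hα n t j).toLp (centredAverage μ Y n t j))
      atTop (𝓝 ((t : ℝ) • (memLp_centredConditionalMean hβ (hα j)).toLp
        (centredConditionalMean μ lam α j))) := by
  rw [← MemLp.toLp_const_smul]
  exact (Lp.tendsto_Lp_iff_tendsto_eLpNorm'' _ (memLp_centredAverage hlam hβ hY hα · t j) _ _).2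
    (tendsto_eLpNorm_average hlam hβ hY (hα j) t)

lemma measurable_scaled_aggregatedSum (hY : IsRandomizedINARFamily μ lam α Y) (N n : ℕ) (t : ℝ≥0) :
    Measurable fun ω => (n : ℝ)⁻¹ * (N : ℝ) ^ (-(1 / 2) : ℝ) * aggregatedSum μ Y N n t ω := by
  have := measurable_inarPath_noise_real hY
  unfold aggregatedSum
  fun_prop

/-- The law of `(Y j, α j)` does not depend on `j`. -/
lemma identDistrib_pair (hY : IsRandomizedINARFamily μ lam α Y)
    (hα : ∀ j, HasMixingDensity μ (α j) ψ β ψ₁) (j : ℕ) :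
    IdentDistrib (fun ω => (α j ω, Y j ω)) (fun ω => (α 0 ω, Y 0 ω)) μ μ :=
  hY.identDistrib (by rw [(hα j).law, (hα 0).law])

lemma integral_inarPath_noise_eq (hY : IsRandomizedINARFamily μ lam α Y)
    (hα : ∀ j, HasMixingDensity μ (α j) ψ β ψ₁) (j k : ℕ) :
    ∫ ω, (inarPath (Y j ω) k : ℝ) ∂μ = ∫ ω, (inarPath (Y 0 ω) k : ℝ) ∂μ :=
  ((identDistrib_pair hY hα j).comp
    ((measurable_inarPath_real k).comp measurable_snd)).integral_eq

lemma integral_centredAverage (hlam : 0 < lam) (hβ : 1 < β) (hY : IsRandomizedINARFamily μ lam α Y)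
    (hα : ∀ j, HasMixingDensity μ (α j) ψ β ψ₁) (n : ℕ) (t : ℝ≥0) (j : ℕ) :
    ∫ ω, centredAverage μ Y n t j ω ∂μ = 0 := by
  have hi := fun k => (memLp_inarPath_noise hlam hβ hY (hα j) k).integrable one_le_two
  have hi' : ∀ k, Integrable (fun ω => (inarPath (Y j ω) k : ℝ) -
      ∫ ω', (inarPath (Y j ω') k : ℝ) ∂μ) μ := fun k => (hi k).sub (integrable_const _)
  simp_rw [centredAverage]
  rw [integral_const_mul, integral_finsetSum _ fun k _ => hi' k]
  simp [integral_sub (hi _) (integrable_const _)]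

/-- Linear combinations of the centred averages as a function of the driving variables. -/
lemma exists_measurable_centredAverage (hY : IsRandomizedINARFamily μ lam α Y)
    (hα : ∀ j, HasMixingDensity μ (α j) ψ β ψ₁) {ι : Type*} [Fintype ι] (θ : ι → ℝ)
    (τ : ι → ℝ≥0) (n : ℕ) :
    ∃ φ : ℝ × INARNoise → ℝ, Measurable φ ∧
      ∀ j ω, ∑ t, θ t * centredAverage μ Y n (τ t) j ω = φ (α j ω, Y j ω) := by
  have hm : ∀ k, Measurable fun p : ℝ × INARNoise => (inarPath p.2 k : ℝ) := fun k =>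
    (measurable_inarPath_real k).comp measurable_snd
  refine ⟨fun p => ∑ t, θ t * ((n : ℝ)⁻¹ * ∑ k ∈ Finset.Icc 1 ⌊(n : ℝ) * τ t⌋₊,
    ((inarPath p.2 k : ℝ) - ∫ ω', (inarPath (Y 0 ω') k : ℝ) ∂μ)), by fun_prop, fun j ω => ?_⟩
  simp_rw [centredAverage, integral_inarPath_noise_eq hY hα j]

lemma exists_measurable_centredConditionalMean (hY : IsRandomizedINARFamily μ lam α Y)
    (hα : ∀ j, HasMixingDensity μ (α j) ψ β ψ₁) :
    ∃ φ : ℝ × INARNoise → ℝ, Measurable φ ∧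
      ∀ j ω, centredConditionalMean μ lam α j ω = φ (α j ω, Y j ω) := by
  refine ⟨fun p => lam * ((1 - p.1)⁻¹ - ∫ ω', (1 - α 0 ω')⁻¹ ∂μ), by fun_prop, fun j ω => ?_⟩
  have : ∫ ω', (1 - α j ω')⁻¹ ∂μ = ∫ ω', (1 - α 0 ω')⁻¹ ∂μ :=
    ((identDistrib_pair hY hα j).comp (u := fun p : ℝ × INARNoise => (1 - p.1)⁻¹) (by fun_prop)).integral_eq
  rw [centredConditionalMean, this]

/-- The central limit theorem for functionals of the copies. -/
lemma tendsto_charFun_sum_copies (hY : IsRandomizedINARFamily μ lam α Y)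
    (hα : ∀ j, HasMixingDensity μ (α j) ψ β ψ₁) {B : ℕ → Ω → ℝ} {φ : ℝ × INARNoise → ℝ}
    (hφ : Measurable φ) (hBφ : ∀ j ω, B j ω = φ (α j ω, Y j ω)) (hB : MemLp (B 0) 2 μ)
    (h0 : μ[B 0] = 0) :
    Tendsto (fun N : ℕ => charFun (μ.map fun ω => (√N)⁻¹ * ∑ j ∈ Finset.range N, B j ω) 1) atTop
      (𝓝 (charFun (gaussianReal 0 (‖hB.toLp (B 0)‖ ^ 2).toNNReal) 1)) := by
  obtain rfl : B = fun j ω => φ (α j ω, Y j ω) := by ext j ω; exact hBφ j ω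
  exact tendsto_charFun_inv_sqrt_mul_sum hB h0 (hY.indep.comp (fun _ => φ) fun _ => hφ)
    fun i => (identDistrib_pair hY hα i).comp hφ

lemma norm_toLp_centredConditionalMean_sq (hβ : 1 < β)
    (hα : ∀ j, HasMixingDensity μ (α j) ψ β ψ₁) :
    ‖(memLp_centredConditionalMean (lam := lam) hβ (hα 0)).toLp
      (centredConditionalMean μ lam α 0)‖ ^ 2 =
      lam ^ 2 * Var[fun ω => (1 - α 0 ω)⁻¹; μ] := by
  rw [norm_toLp_two_sq, variance_eq_integral ((hα 0).memLp_inv hβ).aemeasurable,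
    ← integral_const_mul]
  simp_rw [centredConditionalMean, mul_pow]

lemma charFun_sum_mul_gaussian {Ω' : Type*} [MeasurableSpace Ω'] {ν : Measure Ω'}
    {W : Ω' → ℝ} (hβ : 1 < β) (hα : ∀ j, HasMixingDensity μ (α j) ψ β ψ₁)
    (hW : HasLaw W
      (gaussianReal 0 (lam ^ 2 * Var[fun ω => (1 - α 0 ω)⁻¹; μ]).toNNReal) ν)
    {ι : Type*} [Fintype ι] (θ : ι → ℝ) (τ : ι → ℝ≥0) :
    charFun (ν.map fun ω => ∑ t, θ t * (W ω * τ t)) 1 =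
      charFun (gaussianReal 0 (‖(∑ t, θ t * (τ t : ℝ)) •
        (memLp_centredConditionalMean (lam := lam) hβ (hα 0)).toLp
          (centredConditionalMean μ lam α 0)‖ ^ 2).toNNReal) 1 := by
  have e : (fun ω => ∑ t, θ t * (W ω * τ t)) = fun ω => (∑ t, θ t * (τ t : ℝ)) * W ω := by
    ext ω
    rw [Finset.sum_mul]
    exact Finset.sum_congr rfl fun t _ => by ring
  rw [e, charFun_map_mul_comp hW.aemeasurable, hW.map_eq, norm_smul, mul_pow,
    norm_toLp_centredConditionalMean_sq hβ hα, charFun_gaussianReal, charFun_gaussianReal,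
    Real.coe_toNNReal _ (mul_nonneg (sq_nonneg _) (variance_nonneg _ _)),
    Real.coe_toNNReal _ (mul_nonneg (sq_nonneg _)
      (mul_nonneg (sq_nonneg _) (variance_nonneg _ _))), Real.norm_eq_abs, sq_abs]
  congr 1
  push_cast
  ring

/-- First many copies, then long time. -/
lemma iteratedFddLimit_copies_then_time (hlam : 0 < lam) (hβ : 1 < β)
    (hY : IsRandomizedINARFamily μ lam α Y) (hα : ∀ j, HasMixingDensity μ (α j) ψ β ψ₁)
    {Ω' : Type*} [MeasurableSpace Ω'] {ν : Measure Ω'} [IsProbabilityMeasure ν] {W : Ω' → ℝ}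
    (hW : HasLaw W
      (gaussianReal 0 (lam ^ 2 * Var[fun ω => (1 - α 0 ω)⁻¹; μ]).toNNReal) ν) :
    IteratedFddLimit
      (fun n N t ω => (n : ℝ)⁻¹ * (N : ℝ) ^ (-(1 / 2) : ℝ) * aggregatedSum μ Y N n t ω) μ
      (fun t ω => W ω * t) ν := by
  -- The centred values of copy 0 as L² vectors: their Gram matrix is the covariance matrix of the
  -- path.
  set f : ℕ → Lp ℝ 2 μ := fun k =>
    ((memLp_inarPath_noise hlam hβ hY (hα 0) k).sub (memLp_const
      (∫ ω', (inarPath (Y 0 ω') k : ℝ) ∂μ))).toLp _ with hf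
  obtain ⟨P, hP⟩ := exists_gaussian_sequence f
  have hg : ∀ n : ℕ, Measurable fun (w : ℕ → ℝ) (t : ℝ≥0) =>
      (n : ℝ)⁻¹ * ∑ k ∈ Finset.Icc 1 ⌊(n : ℝ) * t⌋₊, w k := fun n => by fun_prop
  have hAf : ∀ n t, (memLp_centredAverage hlam hβ hY hα n t 0).toLp (centredAverage μ Y n t 0) =
      (n : ℝ)⁻¹ • ∑ k ∈ Finset.Icc 1 ⌊(n : ℝ) * t⌋₊, f k := fun n t => by
    have := toLp_finsetSum_mul (Finset.Icc 1 ⌊(n : ℝ) * t⌋₊) (fun _ => (n : ℝ)⁻¹)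
      fun k => (memLp_inarPath_noise hlam hβ hY (hα 0) k).sub (memLp_const
      (∫ ω', (inarPath (Y 0 ω') k : ℝ) ∂μ))
    rw [Finset.smul_sum, ← this]
    congr 1
    ext ω
    rw [centredAverage, Finset.mul_sum]
    rfl
  -- The limit for fixed `n` is the same time average applied to the Gaussian sequence with
  -- covariances of the path.
  obtain ⟨Q, hQ⟩ : ∃ Q : ℕ → ProbabilityMeasure (ℝ≥0 → ℝ), ∀ n, (Q n : Measure (ℝ≥0 → ℝ)) =
      (P : Measure (ℕ → ℝ)).map fun w (t : ℝ≥0) =>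
        (n : ℝ)⁻¹ * ∑ k ∈ Finset.Icc 1 ⌊(n : ℝ) * t⌋₊, w k :=
    ⟨fun n => ⟨_, Measure.isProbabilityMeasure_map (hg n).aemeasurable⟩, fun n => rfl⟩
  have hlaw : ∀ (n : ℕ) (I : Finset ℝ≥0) (θ : I → ℝ),
      (Q n : Measure (ℝ≥0 → ℝ)).map (fun v : ℝ≥0 → ℝ => ∑ t, θ t * v t) =
      gaussianReal 0 (‖∑ t, θ t • (memLp_centredAverage hlam hβ hY hα n t 0).toLp
        (centredAverage μ Y n t 0)‖ ^ 2).toNNReal := fun n I θ => by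
    rw [hQ, Measure.map_map (by fun_prop) (hg n)]
    simp_rw [hAf, smul_smul]
    rw [sum_smul_sum_eq_sum_biUnion, ← hP]
    congr 1
    ext w
    have := sum_smul_sum_eq_sum_biUnion (fun t : I => θ t * (n : ℝ)⁻¹)
      (fun t => Finset.Icc 1 ⌊(n : ℝ) * t⌋₊) w
    simp only [smul_eq_mul] at this
    rw [← this]
    simp only [Function.comp_apply, mul_assoc]
  refine ⟨Q, fun n _ => ?_, ?_⟩
  · refine fddTendsto_of_tendsto_charFun
      (fun N t => (measurable_scaled_aggregatedSum hY N n t).aemeasurable)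
      (fun t => (measurable_pi_apply t).aemeasurable) fun I θ => ?_
    obtain ⟨φ, hφ, hBφ⟩ := exists_measurable_centredAverage hY hα θ (fun t : I => (t : ℝ≥0)) n
    simp_rw [sum_mul_scaled_aggregatedSum θ (fun t : I => (t : ℝ≥0))]
    rw [hlaw, ← toLp_finsetSum_mul]
    refine tendsto_charFun_sum_copies hY hα hφ hBφ _ ?_
    rw [integral_finsetSum _ fun (t : I) _ =>
      ((memLp_centredAverage hlam hβ hY hα n t 0).integrable one_le_two).const_mul (θ t)]
    simp [integral_const_mul, integral_centredAverage hlam hβ hY hα]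
  · refine fddTendsto_of_tendsto_charFun (fun n t => (measurable_pi_apply t).aemeasurable)
      (fun t => hW.aemeasurable.mul_const _) fun I θ => ?_
    simp only [hlaw]
    rw [charFun_sum_mul_gaussian hβ hα hW θ (fun t : I => (t : ℝ≥0))]
    refine tendsto_charFun_gaussianReal (Tendsto.pow (Tendsto.norm ?_) 2) 1
    simp_rw [Finset.sum_smul, mul_smul]
    exact tendsto_finsetSum _ fun t _ => (tendsto_toLp_centredAverage hlam hβ hY hα t 0).const_smul _

/-- First long time, then many copies. -/
lemma iteratedFddLimit_time_then_copies (hlam : 0 < lam) (hβ : 1 < β)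
    (hY : IsRandomizedINARFamily μ lam α Y) (hα : ∀ j, HasMixingDensity μ (α j) ψ β ψ₁)
    {Ω' : Type*} [MeasurableSpace Ω'] {ν : Measure Ω'} [IsProbabilityMeasure ν] {W : Ω' → ℝ}
    (hW : HasLaw W
      (gaussianReal 0 (lam ^ 2 * Var[fun ω => (1 - α 0 ω)⁻¹; μ]).toNNReal) ν) :
    IteratedFddLimit
      (fun N n t ω => (n : ℝ)⁻¹ * (N : ℝ) ^ (-(1 / 2) : ℝ) * aggregatedSum μ Y N n t ω) μ
      (fun t ω => W ω * t) ν := by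
  have hc := fun j => memLp_centredConditionalMean (lam := lam) hβ (hα j)
  have hcm : ∀ j, Measurable (centredConditionalMean μ lam α j) := fun j => by
    have := hY.measurable_coeff j
    unfold centredConditionalMean
    fun_prop
  have hg : ∀ N : ℕ, Measurable fun ω (t : ℝ≥0) =>
      (√N)⁻¹ * ∑ j ∈ Finset.range N, t * centredConditionalMean μ lam α j ω := fun N => by fun_prop
  -- For fixed `N` the limit is a random line, whose slope is the normalized sum of the centred
  -- conditional means.
  obtain ⟨Q, hQ⟩ : ∃ Q : ℕ → ProbabilityMeasure (ℝ≥0 → ℝ), ∀ N, (Q N : Measure (ℝ≥0 → ℝ)) =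
      μ.map fun ω (t : ℝ≥0) =>
        (√N)⁻¹ * ∑ j ∈ Finset.range N, t * centredConditionalMean μ lam α j ω :=
    ⟨fun N => ⟨_, Measure.isProbabilityMeasure_map (hg N).aemeasurable⟩, fun N => rfl⟩
  have hlaw : ∀ (N : ℕ) (I : Finset ℝ≥0) (θ : I → ℝ),
      (Q N : Measure (ℝ≥0 → ℝ)).map (fun v : ℝ≥0 → ℝ => ∑ t, θ t * v t) =
      μ.map fun ω => (√N)⁻¹ * ∑ j ∈ Finset.range N,
        (∑ t, θ t * (t : ℝ)) * centredConditionalMean μ lam α j ω := fun N I θ => by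
    rw [hQ, Measure.map_map (by fun_prop) (hg N)]
    congr 1
    ext ω
    simp only [Function.comp_apply]
    simp_rw [← Finset.mul_sum]
    rw [Finset.sum_mul, Finset.mul_sum]
    exact Finset.sum_congr rfl fun t _ => by ring
  refine ⟨Q, fun N _ => ?_, ?_⟩
  · refine fddTendsto_of_tendsto_charFun
      (fun n t => (measurable_scaled_aggregatedSum hY N n t).aemeasurable)
      (fun t => (measurable_pi_apply t).aemeasurable) fun I θ => ?_
    simp_rw [sum_mul_scaled_aggregatedSum θ (fun t : I => (t : ℝ≥0)), Finset.mul_sum]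
    rw [hlaw]
    simp_rw [Finset.mul_sum]
    have hA := fun n j => memLp_finsetSum_mul Finset.univ θ
      fun t : I => memLp_centredAverage hlam hβ hY hα n t j
    have hθ := fun j => (hc j).const_mul (∑ t, θ t * (t : ℝ))
    -- Only the sum over times is refolded, leaving a sum over copies with constant coefficient
    -- `(√N)⁻¹`.
    simp_rw [← Finset.mul_sum Finset.univ]
    refine tendsto_charFun_of_tendsto_toLp (memLp_finsetSum_mul _ (fun _ => (√N)⁻¹) <| hA ·)
      (memLp_finsetSum_mul _ (fun _ => (√N)⁻¹) hθ) ?_ 1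
    simp_rw [fun n => toLp_finsetSum_mul (Finset.range N) (fun _ => (√N)⁻¹) (hA n),
      toLp_finsetSum_mul (Finset.range N) (fun _ => (√N)⁻¹) hθ]
    refine tendsto_finsetSum _ fun j _ => Tendsto.const_smul ?_ _
    have e : (hθ j).toLp _ = (∑ t, θ t * (t : ℝ)) • (hc j).toLp _ :=
      MemLp.toLp_const_smul (∑ t, θ t * (t : ℝ)) (hc j)
    simp_rw [fun n => toLp_finsetSum_mul Finset.univ θ
      fun t : I => memLp_centredAverage hlam hβ hY hα n t j]
    rw [e, Finset.sum_smul]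
    simp_rw [mul_smul]
    exact tendsto_finsetSum _ fun t _ => (tendsto_toLp_centredAverage hlam hβ hY hα t j).const_smul _
  · refine fddTendsto_of_tendsto_charFun (fun n t => (measurable_pi_apply t).aemeasurable)
      (fun t => hW.aemeasurable.mul_const _) fun I θ => ?_
    simp only [hlaw]
    rw [charFun_sum_mul_gaussian hβ hα hW θ (fun t : I => (t : ℝ≥0)), ← MemLp.toLp_const_smul]
    obtain ⟨φ, hφ, hBφ⟩ := exists_measurable_centredConditionalMean hY hα
    refine tendsto_charFun_sum_copies hY hα (hφ.const_mul _)
      (fun j ω => by rw [hBφ]) ((hc 0).const_mul _) ?_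
    rw [integral_const_mul]
    simp_rw [centredConditionalMean]
    rw [integral_const_mul, integral_sub (((hα 0).memLp_inv hβ).integrable one_le_two)
      (integrable_const _)]
    simp

end

theorem mainTheorem7 {Ω : Type*} [MeasurableSpace Ω] (μ : Measure Ω) [IsProbabilityMeasure μ]
    (lam β ψ₁ : ℝ) (ψ : ℝ → ℝ) (hlam : 0 < lam) (hβ : 1 < β)
    (α : ℕ → Ω → ℝ) (Y : ℕ → Ω → INARNoise)
    (hα : ∀ j, HasMixingDensity μ (α j) ψ β ψ₁)
    (hY : IsRandomizedINARFamily μ lam α Y)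
    {Ω' : Type*} [MeasurableSpace Ω'] (ν : Measure Ω') [IsProbabilityMeasure ν] (W : Ω' → ℝ)
    (hW : HasLaw W
      (gaussianReal 0 (lam ^ 2 * Var[fun ω => (1 - α 0 ω)⁻¹; μ]).toNNReal) ν) :
    (∀ j k, Integrable (fun ω => (inarPath (Y j ω) k : ℝ)) μ) ∧
    MemLp (fun ω => (1 - α 0 ω)⁻¹) 2 μ ∧
    IteratedFddLimit
      (fun n N t ω => (n : ℝ)⁻¹ * (N : ℝ) ^ (-(1 / 2) : ℝ) * aggregatedSum μ Y N n t ω) μ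
      (fun t ω => W ω * t) ν ∧
    IteratedFddLimit
      (fun N n t ω => (n : ℝ)⁻¹ * (N : ℝ) ^ (-(1 / 2) : ℝ) * aggregatedSum μ Y N n t ω) μ
      (fun t ω => W ω * t) ν :=
  ⟨fun j k => (memLp_inarPath_noise hlam hβ hY (hα j) k).integrable one_le_two,
    (hα 0).memLp_inv hβ, iteratedFddLimit_copies_then_time hlam hβ hY hα hW,
    iteratedFddLimit_time_then_copies hlam hβ hY hα hW⟩
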